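/- For an integer $m\ge 0$ let $H^m_{\mathrm{per}}([0,1])$ be the space of $1$-periodic functions on $\mathbb R$ that belong to $H^m_{\mathrm{loc}}(\mathbb R)$, with the norm of $H^m([0,1])$; $L^2_{\mathrm{per}}=H^0_{\mathrm{per}}$. For $T>0$ consider the equation $u_t=-u^2(u^3)_{hhhh}$ for functions $u(t,h)$, $t\in[0,T]$, that are $1$-periodic in $h\in\mathbb R$. Put $$F(u)=\tfrac12\int_0^1u^2\,dh,\qquad E(u)=\tfrac16\int_0^1[(u^3)_{hh}]^2\,dh,\qquad P_T=\big((0,T)\times(0,1)\big)\setminus\{(t,h):u(t,h)=0\}.$$ A non-negative function $u$, $1$-periodic in $h$, is a weak solution on $[0,T]$ with initial data $u_0$ if $u(0,\cdot)=u_0$, $$u^3\in L^\infty([0,T];H^2_{\mathrm{per}}([0,1])),\quad u^2(u^3)_{hhhh}\in L^2(P_T),\quad u_t\in L^2([0,T];L^2_{\mathrm{per}}([0,1])),\quad u^3\in C([0,T];H^1_{\mathrm{per}}([0,1])),$$ where $u^3$ is identified with its continuous representative and $(u^3)_{hhhh}$ is the distributional derivative on the open set $\{(t,h)\in(0,T)\times\mathbb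 R: u(t,h)\neq0\}$ (that is, the derivative is periodic in $h$), and if (i) for every $\phi\in C^\infty([0,T]\times\mathbb R)$ that is $1$-periodic in $h$, $$\int_0^T\!\!\int_0^1\phi\,u_t\,dh\,dt+\iint_{P_T}\phi\,u^2(u^3)_{hhhh}\,dh\,dt=0;$$ (ii) $\displaystyle E(u(T,\cdot))+\iint_{P_T}\big(u^2(u^3)_{hhhh}\big)^2\,dh\,dt\le E(u(0,\cdot))$; (iii) $\displaystyle F(u(T,\cdot))+6\int_0^TE(u(t,\cdot))\,dt\le F(u(0,\cdot))$. **Proposition.** There is a function $C:[0,\infty)\to\mathbb R$ such that the following holds. Let $T>0$, let $u_0\ge0$ satisfy $u_0^3\in H^2_{\mathrm{per}}([0,1])$ and $\int_0^1\frac1{u_0}\,dh<\infty$, and let $u$ be a non-negative weak solution on $[0,T]$ with initial data $u_0$. Then $$|u^3(t_1,h)-u^3(t_2,h)|\le C\big(\|u_0^3\|_{H^2([0,1])}\big)\,|t_2-t_1|^{1/4}\qquad\text{for all }t_1,t_2\in[0,T],\ h\in[0,1],$$ and $u^3(t,\cdot)\in C^{1/2}([0,1])$ for every $t\in[0,T]$.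 -/

import Mathlib

open MeasureTheory Set Filter Topology
open scoped ContDiff

namespace Vicinal

/-- `g` is the `k`-th weak (distributional) derivative of `f` on the real line. -/
def HasWeakDeriv (k : ℕ) (f g : ℝ → ℝ) : Prop :=
  LocallyIntegrable f ∧ LocallyIntegrable g ∧
    ∀ φ : ℝ → ℝ, ContDiff ℝ ∞ φ → HasCompactSupport φ →
      ∫ h, f h * iteratedDeriv k φ h = (-1 : ℝ) ^ k * ∫ h, g h * φ h

/-- The square of the norm of the `k`-th weak derivative of `f` in `L²(0,1)`, with value `⊤` if `f`
has no locally integrable `k`-th weak derivative (the infimum is over the empty set then; otherwise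
the weak derivative is unique almost everywhere and the infimum is over a single value). -/
noncomputable def derivL2Sq (k : ℕ) (f : ℝ → ℝ) : ENNReal :=
  ⨅ (g : ℝ → ℝ) (_ : HasWeakDeriv k f g), ∫⁻ h in Ioo (0 : ℝ) 1, ENNReal.ofReal (g h ^ 2)

/-- The norm of `H^m([0,1])`, with value `⊤` outside the space. -/
noncomputable def sobolevNorm (m : ℕ) (f : ℝ → ℝ) : ENNReal :=
  (∑ k ∈ Finset.range (m + 1), derivL2Sq k f) ^ (1 / 2 : ℝ)

/-- `f ∈ H^m_per([0,1])`: `f` is `1`-periodic and lies in `H^m` on a period, with weak derivatives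
on the whole line (hence across the end points of the period too). -/
def MemHper (m : ℕ) (f : ℝ → ℝ) : Prop :=
  (∀ᵐ h : ℝ, f (h + 1) = f h) ∧ sobolevNorm m f < ⊤

/-- `v = ∂_t f` in the sense of distributions on the open set `Ω` of points `(t, h)`. -/
def HasWeakTimeDerivOn (Ω : Set (ℝ × ℝ)) (f v : ℝ × ℝ → ℝ) : Prop :=
  LocallyIntegrableOn f Ω ∧ LocallyIntegrableOn v Ω ∧
    ∀ φ : ℝ × ℝ → ℝ, ContDiff ℝ ∞ φ → HasCompactSupport φ → tsupport φ ⊆ Ω →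
      ∫ p, f p * deriv (fun s => φ (s, p.2)) p.1 = -∫ p, v p * φ p

/-- `z = ∂_h^k f` in the sense of distributions on the open set `Ω` of points `(t, h)`. -/
def HasWeakSpaceDerivOn (k : ℕ) (Ω : Set (ℝ × ℝ)) (f z : ℝ × ℝ → ℝ) : Prop :=
  LocallyIntegrableOn f Ω ∧ LocallyIntegrableOn z Ω ∧
    ∀ φ : ℝ × ℝ → ℝ, ContDiff ℝ ∞ φ → HasCompactSupport φ → tsupport φ ⊆ Ω →
      ∫ p, f p * iteratedDeriv k (fun s => φ (p.1, s)) p.2 = (-1 : ℝ) ^ k * ∫ p, z p * φ p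

/-- `F(u) = (1/2) ∫₀¹ u² dh`. -/
noncomputable def F (u : ℝ → ℝ) : ENNReal :=
  (∫⁻ h in Ioo (0 : ℝ) 1, ENNReal.ofReal (u h ^ 2)) / 2

/-- `E(u) = (1/6) ∫₀¹ [(u³)_hh]² dh`. -/
noncomputable def E (u : ℝ → ℝ) : ENNReal :=
  derivL2Sq 2 (fun h => u h ^ 3) / 6

/-- The non-degenerate set in the periodic strip `(0,T) × ℝ`. It carries the distribution
`(u³)_hhhh`, which is thereby taken in the periodic sense (`h = 0` and `h = 1` are identified). -/
def positivitySet (T : ℝ) (u : ℝ → ℝ → ℝ) : Set (ℝ × ℝ) :=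
  {p | p.1 ∈ Ioo 0 T ∧ u p.1 p.2 ≠ 0}

/-- `P_T`, the set of points of `(0,T) × (0,1)` at which `u` does not vanish. -/
def PT (T : ℝ) (u : ℝ → ℝ → ℝ) : Set (ℝ × ℝ) :=
  (Ioo 0 T ×ˢ Ioo 0 1) \ {p | u p.1 p.2 = 0}

/-- Non-negative weak solutions `u(t,h)`, `t ∈ [0,T]`, of `u_t = -u² (u³)_hhhh`, `1`-periodic in
`h`, with initial data `u₀`. The function `u³ ∈ C([0,T]; H¹_per)` is identified with its continuous
representative in `h`. Only the values `u t h` with `t ∈ [0,T]` matter. -/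
def IsWeakSolution (T : ℝ) (u₀ : ℝ → ℝ) (u : ℝ → ℝ → ℝ) : Prop :=
  (∀ t ∈ Icc 0 T, ∀ h, 0 ≤ u t h) ∧
  (∀ t ∈ Icc 0 T, Continuous (u t)) ∧
  (∀ᵐ h : ℝ, u 0 h = u₀ h) ∧
  -- `u³ ∈ L^∞([0,T]; H²_per)`
  (∃ K : NNReal, ∀ᵐ t : ℝ, t ∈ Icc 0 T →
    MemHper 2 (fun h => u t h ^ 3) ∧ sobolevNorm 2 (fun h => u t h ^ 3) ≤ K) ∧
  -- `u³ ∈ C([0,T]; H¹_per)`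
  (∀ t ∈ Icc 0 T, MemHper 1 (fun h => u t h ^ 3)) ∧
  (∀ t₀ ∈ Icc 0 T, Tendsto (fun t => sobolevNorm 1 (fun h => u t h ^ 3 - u t₀ h ^ 3))
    (𝓝[Icc 0 T] t₀) (𝓝 0)) ∧
  -- `ut` is `u_t` and `z` is `(u³)_hhhh`
  ∃ ut z : ℝ × ℝ → ℝ,
    HasWeakTimeDerivOn (Ioo 0 T ×ˢ univ) (fun p => u p.1 p.2) ut ∧
    MemLp ut 2 (volume.restrict (Ioo 0 T ×ˢ Ioo 0 1)) ∧
    HasWeakSpaceDerivOn 4 (positivitySet T u) (fun p => u p.1 p.2 ^ 3) z ∧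
    MemLp (fun p => u p.1 p.2 ^ 2 * z p) 2 (volume.restrict (PT T u)) ∧
    -- the equation
    (∀ φ : ℝ × ℝ → ℝ, ContDiffOn ℝ ∞ φ (Icc 0 T ×ˢ univ) →
      (∀ t ∈ Icc 0 T, ∀ h, φ (t, h + 1) = φ (t, h)) →
      (∫ p in Ioo 0 T ×ˢ Ioo 0 1, φ p * ut p) +
        (∫ p in PT T u, φ p * (u p.1 p.2 ^ 2 * z p)) = 0) ∧
    -- the first energy-dissipation inequality
    E (u T) + (∫⁻ p in PT T u, ENNReal.ofReal ((u p.1 p.2 ^ 2 * z p) ^ 2)) ≤ E (u 0) ∧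
    -- the second energy-dissipation inequality
    F (u T) + 6 * (∫⁻ t in Ioo 0 T, E (u t)) ≤ F (u 0)

/-- The assumptions on the initial data: `u₀ ≥ 0`, `u₀³ ∈ H²_per([0,1])` and
`∫₀¹ 1/u₀ dh < ⊤`, where `1/0 = ∞`. -/
def AdmissibleData (u₀ : ℝ → ℝ) : Prop :=
  (∀ h, 0 ≤ u₀ h) ∧ MemHper 2 (fun h => u₀ h ^ 3) ∧
    (∫⁻ h in Ioo (0 : ℝ) 1, (ENNReal.ofReal (u₀ h))⁻¹) < ⊤

end Vicinal

namespace Vicinal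

/-! Write $w=u^3$, $N=\|u_0^3\|_{H^2}$ and $a=\sup u$. The two dissipation inequalities compare only
the times $0$ and $T$, but they give space-time bounds independent of $T$: since $u_t=-u^2w_{hhhh}$
on $P_T$ and $u_t=0$ a.e. off it, (ii) gives $\iint u_t^2\le N^2$, and (iii) gives $\iint
w_{hh}^2\le 1+N^2$.

Regularity in space at a fixed time comes from $\frac12\frac{d}{dt}\int w_h^2=-\int 3u^2u_tw_{hh}$,
whence $\int w_h^2\le(1+N^2)(1+6a^2)$ by Cauchy–Schwarz (`EnergySolution.integral_sq_sub_le`). This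
is done with difference quotients, as $w_h$ has too little regularity in time. It makes $w(t,\cdot)$
Hölder continuous with exponent $1/2$, with a constant depending on $a$.

The bound on $a$ is the heart of the matter (`EnergySolution.le_bound`). The squared oscillation of
$w(t,\cdot)$ is $O(a^2)$, while $w$ reaches $a^3$; so for large $a$ the function $w$ is almost
constant in space whenever it is comparable to $a^3$. Going back from the time of the maximum to the
last time at which $w$ was $a^3/2$ at the maximum point, $u$ stays positive in between. There
$\frac{d}{dt}\int\frac1u=\int w_{hhhh}=0$ by periodicity (`EnergySolution.integral_inv_eq`),
although $u$ has become strictly larger everywhere: a contradiction.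

Finally $\|u(t)-u(s)\|_{L^2}^2\le N^2|t-s|$, and interpolating this with the Hölder bound in space
over an interval of length $\sqrt{|t-s|}$ gives the exponent $1/4$ in time
(`EnergySolution.abs_cube_sub_le`). -/

theorem HasWeakDeriv.ae_eq_of_zero {f g : ℝ → ℝ} (h : HasWeakDeriv 0 f g) : f =ᵐ[volume] g := by
  obtain ⟨hf, hg, H⟩ := h
  refine ae_eq_of_integral_contDiff_smul_eq hf hg fun φ hφ hc => ?_
  have := H φ hφ hc
  simp only [iteratedDeriv_zero, pow_zero, one_mul] at this
  simpa only [smul_eq_mul, mul_comm] using this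

/-! ### Smooth approximations of point masses and of indicator functions. -/

theorem deriv_smoothTransition_eq_zero {x : ℝ} (hx : x ∉ Icc (0 : ℝ) 1) :
    deriv Real.smoothTransition x = 0 := by
  rcases lt_or_ge x 0 with h | h
  · have : Real.smoothTransition =ᶠ[𝓝 x] fun _ => 0 := by
      filter_upwards [Iio_mem_nhds h] with y hy
      exact Real.smoothTransition.zero_of_nonpos (le_of_lt hy)
    rw [this.deriv_eq, deriv_const]
  · have h1 : 1 < x := by
      by_contra h1
      exact hx ⟨h, not_lt.1 h1⟩
    have : Real.smoothTransition =ᶠ[𝓝 x] fun _ => 1 := by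
      filter_upwards [Ioi_mem_nhds h1] with y hy
      exact Real.smoothTransition.one_of_one_le (le_of_lt hy)
    rw [this.deriv_eq, deriv_const]

theorem hasCompactSupport_deriv_smoothTransition :
    HasCompactSupport (deriv Real.smoothTransition) :=
  HasCompactSupport.intro (isCompact_Icc (a := (0 : ℝ)) (b := 1)) fun _ hx =>
    deriv_smoothTransition_eq_zero hx

theorem continuous_deriv_smoothTransition : Continuous (deriv Real.smoothTransition) :=
  (Real.smoothTransition.contDiff (n := 1)).continuous_deriv le_rfl

theorem integral_deriv_smoothTransition : ∫ x, deriv Real.smoothTransition x = 1 := by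
  have h : ∀ x, HasDerivAt Real.smoothTransition (deriv Real.smoothTransition x) x := fun x =>
    ((Real.smoothTransition.contDiff (n := 1)).differentiable one_ne_zero x).hasDerivAt
  have h0 : Tendsto Real.smoothTransition atBot (𝓝 0) :=
    tendsto_const_nhds.congr' <| by
      filter_upwards [Iic_mem_atBot (0 : ℝ)] with x hx
      exact (Real.smoothTransition.zero_of_nonpos hx).symm
  have h1 : Tendsto Real.smoothTransition atTop (𝓝 1) :=
    tendsto_const_nhds.congr' <| by
      filter_upwards [Ici_mem_atTop (1 : ℝ)] with x hx
      exact (Real.smoothTransition.one_of_one_le hx).symm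
  have := integral_of_hasDerivAt_of_tendsto h
    (continuous_deriv_smoothTransition.integrable_of_hasCompactSupport
      hasCompactSupport_deriv_smoothTransition) h0 h1
  simpa using this

/-- Rescaled derivatives of the smooth transition function are an approximate identity. -/
theorem tendsto_integral_mul_deriv_smoothTransition {f : ℝ → ℝ} (hf : Continuous f) (s : ℝ) :
    Tendsto (fun n : ℕ => ∫ x, f x *
      ((n + 1 : ℝ) * deriv Real.smoothTransition ((x - s) * (n + 1)))) atTop (𝓝 (f s)) := by
  have key : ∀ n : ℕ, ∫ x, f x * ((n + 1 : ℝ) * deriv Real.smoothTransition ((x - s) * (n + 1)))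
      = ∫ y, f (s + y / (n + 1)) * deriv Real.smoothTransition y := by
    intro n
    have hn : (0 : ℝ) < n + 1 := by positivity
    have e1 : ∫ x, f x * ((n + 1 : ℝ) * deriv Real.smoothTransition ((x - s) * (n + 1)))
        = ∫ x, (n + 1 : ℝ) * (f (s + x * (n + 1) / (n + 1)) *
          deriv Real.smoothTransition (x * (n + 1))) := by
      rw [← integral_sub_right_eq_self (fun x => (n + 1 : ℝ) * (f (s + x * (n + 1) / (n + 1)) *
          deriv Real.smoothTransition (x * (n + 1)))) s]
      refine integral_congr_ae (Eventually.of_forall fun x => ?_)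
      have : s + (x - s) * (n + 1) / (n + 1) = x := by field_simp; ring
      simp only [this]; ring
    rw [e1, integral_const_mul, Measure.integral_comp_mul_right
      (fun y => f (s + y / (n + 1)) * deriv Real.smoothTransition y), abs_of_pos (inv_pos.2 hn),
      smul_eq_mul, ← mul_assoc, mul_inv_cancel₀ hn.ne', one_mul]
  simp_rw [key]
  have hlim : f s = ∫ y, f s * deriv Real.smoothTransition y := by
    rw [integral_const_mul, integral_deriv_smoothTransition, mul_one]
  rw [hlim]
  -- After rescaling, the bump lives on $[0,1]$, so only the values of `f` on $[s,s+1]$ enter, for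
  -- every `n`.
  obtain ⟨M, hM⟩ := (isCompact_Icc (a := s) (b := s + 1)).exists_bound_of_continuousOn
    hf.continuousOn
  refine tendsto_integral_of_dominated_convergence
    (fun y => M * |deriv Real.smoothTransition y|) ?_ ?_ ?_ ?_
  · intro n
    exact ((hf.comp (by fun_prop)).mul continuous_deriv_smoothTransition).aestronglyMeasurable
  · exact ((continuous_deriv_smoothTransition.integrable_of_hasCompactSupport
      hasCompactSupport_deriv_smoothTransition).abs).const_mul M
  · intro n
    refine Eventually.of_forall fun y => ?_
    rw [norm_mul, Real.norm_eq_abs (deriv _ _)]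
    by_cases hy : y ∈ Icc (0 : ℝ) 1
    · refine mul_le_mul_of_nonneg_right (hM _ ⟨?_, ?_⟩) (abs_nonneg _)
      · have : 0 ≤ y / ((n : ℝ) + 1) := div_nonneg hy.1 (by positivity)
        linarith
      · have : y / ((n : ℝ) + 1) ≤ 1 := by
          rw [div_le_one (by positivity)]
          have : (0 : ℝ) ≤ n := by positivity
          linarith [hy.2]
        linarith
    · simp [deriv_smoothTransition_eq_zero hy]
  · refine Eventually.of_forall fun y => ?_
    have : Tendsto (fun n : ℕ => s + y / ((n : ℝ) + 1)) atTop (𝓝 (s + 0)) :=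
      tendsto_const_nhds.add
        (tendsto_const_nhds.div_atTop (tendsto_atTop_add_const_right _ _ tendsto_natCast_atTop_atTop))
    rw [add_zero] at this
    exact ((hf.tendsto s).comp this).mul_const _

/-- A smooth function which tends to the indicator function of `(s, t]` as `n → ∞`. -/
noncomputable def smoothStep (s t : ℝ) (n : ℕ) (x : ℝ) : ℝ :=
  Real.smoothTransition ((x - s) * (n + 1)) - Real.smoothTransition ((x - t) * (n + 1))

theorem contDiff_smoothStep (s t : ℝ) (n : ℕ) : ContDiff ℝ ∞ (smoothStep s t n) := by
  unfold smoothStep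
  exact (Real.smoothTransition.contDiff.comp (by fun_prop)).sub
    (Real.smoothTransition.contDiff.comp (by fun_prop))

theorem smoothStep_eq_zero {s t : ℝ} (hst : s ≤ t) {n : ℕ} {x : ℝ}
    (hx : x ∉ Icc s (t + 1 / (n + 1))) : smoothStep s t n x = 0 := by
  have hn : (0 : ℝ) < n + 1 := by positivity
  unfold smoothStep
  rcases lt_or_ge x s with h | h
  · rw [Real.smoothTransition.zero_of_nonpos, Real.smoothTransition.zero_of_nonpos, sub_zero]
    · exact mul_nonpos_of_nonpos_of_nonneg (by linarith) hn.le
    · exact mul_nonpos_of_nonpos_of_nonneg (by linarith) hn.le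
  · have h1 : t + 1 / (n + 1) < x := by
      by_contra h1
      exact hx ⟨h, not_lt.1 h1⟩
    have h2 : 1 ≤ (x - t) * (n + 1) := by
      rw [← div_le_iff₀ hn]
      linarith
    rw [Real.smoothTransition.one_of_one_le, Real.smoothTransition.one_of_one_le h2, sub_self]
    exact h2.trans (mul_le_mul_of_nonneg_right (by linarith) hn.le)

theorem tsupport_smoothStep_subset {s t : ℝ} (hst : s ≤ t) (n : ℕ) :
    tsupport (smoothStep s t n) ⊆ Icc s (t + 1 / (n + 1)) :=
  closure_minimal (fun x hx => by
    by_contra hcon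
    exact hx (smoothStep_eq_zero hst hcon)) isClosed_Icc

theorem hasCompactSupport_smoothStep {s t : ℝ} (hst : s ≤ t) (n : ℕ) :
    HasCompactSupport (smoothStep s t n) :=
  HasCompactSupport.intro isCompact_Icc fun _ hx => smoothStep_eq_zero hst hx

theorem abs_smoothStep_le (s t : ℝ) (n : ℕ) (x : ℝ) : |smoothStep s t n x| ≤ 1 := by
  unfold smoothStep
  rw [abs_le]
  constructor <;>
  linarith [Real.smoothTransition.nonneg ((x - s) * (n + 1)),
    Real.smoothTransition.nonneg ((x - t) * (n + 1)),
    Real.smoothTransition.le_one ((x - s) * (n + 1)),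
    Real.smoothTransition.le_one ((x - t) * (n + 1))]

theorem tendsto_smoothTransition_mul (x : ℝ) :
    Tendsto (fun n : ℕ => Real.smoothTransition (x * (n + 1))) atTop
      (𝓝 ((Ioi (0 : ℝ)).indicator (fun _ => 1) x)) := by
  rcases le_or_gt x 0 with h | h
  · rw [indicator_of_notMem (by simpa using h)]
    refine tendsto_const_nhds.congr fun n => ?_
    rw [Real.smoothTransition.zero_of_nonpos
      (mul_nonpos_of_nonpos_of_nonneg h (by positivity))]
  · rw [indicator_of_mem (by simpa using h)]
    have : Tendsto (fun n : ℕ => x * ((n : ℝ) + 1)) atTop atTop :=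
      (tendsto_atTop_add_const_right _ _ tendsto_natCast_atTop_atTop).const_mul_atTop h
    refine tendsto_const_nhds.congr' ?_
    filter_upwards [this.eventually_ge_atTop 1] with n hn
    rw [Real.smoothTransition.one_of_one_le hn]

theorem tendsto_smoothStep {s t : ℝ} (hst : s ≤ t) (x : ℝ) :
    Tendsto (fun n : ℕ => smoothStep s t n x) atTop
      (𝓝 ((Ioc s t).indicator (fun _ => 1) x)) := by
  have := (tendsto_smoothTransition_mul (x - s)).sub (tendsto_smoothTransition_mul (x - t))
  have e : (Ioi (0 : ℝ)).indicator (fun _ => (1 : ℝ)) (x - s)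
      - (Ioi (0 : ℝ)).indicator (fun _ => 1) (x - t) = (Ioc s t).indicator (fun _ => 1) x := by
    simp only [indicator, mem_Ioi, sub_pos, mem_Ioc]
    split_ifs <;> first | (norm_num; done) | (exfalso; grind)
  rwa [e] at this

theorem deriv_smoothStep (s t : ℝ) (n : ℕ) (x : ℝ) :
    deriv (smoothStep s t n) x =
      (n + 1 : ℝ) * deriv Real.smoothTransition ((x - s) * (n + 1)) -
      (n + 1 : ℝ) * deriv Real.smoothTransition ((x - t) * (n + 1)) := by
  have h : ∀ x, HasDerivAt Real.smoothTransition (deriv Real.smoothTransition x) x := fun x =>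
    ((Real.smoothTransition.contDiff (n := 1)).differentiable one_ne_zero x).hasDerivAt
  have h1 : ∀ c, HasDerivAt (fun x => Real.smoothTransition ((x - c) * (n + 1)))
      ((n + 1 : ℝ) * deriv Real.smoothTransition ((x - c) * (n + 1))) x := by
    intro c
    have := (h ((x - c) * (n + 1))).comp x
      (((hasDerivAt_id x).sub_const c).mul_const ((n : ℝ) + 1))
    simpa [mul_comm, Function.comp_def] using this
  exact ((h1 s).sub (h1 t)).deriv

theorem tendsto_integral_mul_deriv_smoothStep {f : ℝ → ℝ} (hf : Continuous f) (s t : ℝ) :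
    Tendsto (fun n : ℕ => ∫ x, f x * deriv (smoothStep s t n) x) atTop (𝓝 (f s - f t)) := by
  have hint : ∀ (c : ℝ) (n : ℕ), Integrable fun x =>
      f x * ((n + 1 : ℝ) * deriv Real.smoothTransition ((x - c) * (n + 1))) := by
    intro c n
    have hn : (0 : ℝ) < n + 1 := by positivity
    refine Continuous.integrable_of_hasCompactSupport
      (hf.mul (continuous_const.mul (continuous_deriv_smoothTransition.comp (by fun_prop)))) ?_
    refine HasCompactSupport.intro (isCompact_Icc (a := c) (b := c + 1 / (n + 1))) fun x hx => ?_
    rw [deriv_smoothTransition_eq_zero, mul_zero, mul_zero]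
    rintro ⟨h0, h1⟩
    refine hx ⟨?_, ?_⟩
    · linarith [nonneg_of_mul_nonneg_left h0 hn]
    · rw [← le_div_iff₀ hn] at h1
      linarith
  refine ((tendsto_integral_mul_deriv_smoothTransition hf s).sub
    (tendsto_integral_mul_deriv_smoothTransition hf t)).congr fun n => ?_
  rw [← integral_sub (hint s n) (hint t n)]
  refine integral_congr_ae (Eventually.of_forall fun x => ?_)
  simp only [deriv_smoothStep]
  ring

theorem tendsto_integral_mul_smoothStep {α β : ℝ} {g : ℝ → ℝ} (hg : IntegrableOn g (Ioo α β))
    {s t : ℝ} (hs : α < s) (hst : s ≤ t) (ht : t < β) :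
    Tendsto (fun n : ℕ => ∫ x, g x * smoothStep s t n x) atTop (𝓝 (∫ x in s..t, g x)) := by
  have h0 : ∀ᶠ n : ℕ in atTop, t + 1 / ((n : ℝ) + 1) < β := by
    have := (tendsto_one_div_add_atTop_nhds_zero_nat (𝕜 := ℝ)).const_add t
    rw [add_zero] at this
    exact this.eventually_lt_const ht
  have h1 : ∀ᶠ n : ℕ in atTop, ∫ x in Ioo α β, g x * smoothStep s t n x =
      ∫ x, g x * smoothStep s t n x := by
    filter_upwards [h0] with n hn
    refine setIntegral_eq_integral_of_forall_compl_eq_zero fun x hx => ?_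
    rw [smoothStep_eq_zero hst, mul_zero]
    rintro ⟨hx1, hx2⟩
    exact hx ⟨by linarith, by linarith⟩
  have h2 : ∫ x in s..t, g x = ∫ x in Ioo α β, g x * (Ioc s t).indicator (fun _ => 1) x := by
    rw [intervalIntegral.integral_of_le hst]
    have : ∀ x, g x * (Ioc s t).indicator (fun _ => 1) x = (Ioc s t).indicator g x := by
      intro x
      by_cases hx : x ∈ Ioc s t <;> simp [hx]
    simp_rw [this]
    rw [setIntegral_indicator measurableSet_Ioc, inter_eq_right.2]
    exact fun x hx => ⟨hs.trans hx.1, hx.2.trans_lt ht⟩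
  rw [h2]
  refine Tendsto.congr' h1 ?_
  refine tendsto_integral_of_dominated_convergence (fun x => |g x|) ?_ hg.abs ?_ ?_
  · intro n
    exact hg.aestronglyMeasurable.mul (contDiff_smoothStep s t n).continuous.aestronglyMeasurable
  · intro n
    refine Eventually.of_forall fun x => ?_
    rw [norm_mul]
    exact mul_le_of_le_one_right (norm_nonneg _) (abs_smoothStep_le s t n x)
  · exact Eventually.of_forall fun x => (tendsto_smoothStep hst x).const_mul _

/-! ### Weak derivatives on the line: primitives, translation, uniqueness, periodicity. -/

/-- A continuous function with an integrable weak derivative on an interval is a primitive of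
that derivative, up to the end points. -/
theorem sub_eq_integral_of_forall_test {α β : ℝ} {f g : ℝ → ℝ} (hf : Continuous f)
    (hg : IntegrableOn g (Ioo α β))
    (H : ∀ χ : ℝ → ℝ, ContDiff ℝ ∞ χ → HasCompactSupport χ → tsupport χ ⊆ Ioo α β →
      ∫ t, f t * deriv χ t = -∫ t, g t * χ t)
    {s t : ℝ} (hs : α ≤ s) (hst : s ≤ t) (ht : t ≤ β) : f t - f s = ∫ x in s..t, g x := by
  rcases hst.eq_or_lt with rfl | hlt
  · simp
  have inner : ∀ s t, α < s → s ≤ t → t < β → f t - f s = ∫ x in s..t, g x := by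
    intro s t hs hst ht
    have h0 : ∀ᶠ n : ℕ in atTop, t + 1 / ((n : ℝ) + 1) < β := by
      have := (tendsto_one_div_add_atTop_nhds_zero_nat (𝕜 := ℝ)).const_add t
      rw [add_zero] at this
      exact this.eventually_lt_const ht
    have h1 : ∀ᶠ n : ℕ in atTop, ∫ x, f x * deriv (smoothStep s t n) x =
        -∫ x, g x * smoothStep s t n x := by
      filter_upwards [h0] with n hn
      exact H _ (contDiff_smoothStep s t n) (hasCompactSupport_smoothStep hst n)
        ((tsupport_smoothStep_subset hst n).trans fun x hx =>
          ⟨hs.trans_le hx.1, hx.2.trans_lt hn⟩)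
    have := tendsto_nhds_unique_of_eventuallyEq (tendsto_integral_mul_deriv_smoothStep hf s t)
      (tendsto_integral_mul_smoothStep hg hs hst ht).neg h1
    linarith
  have hαβ : α ≤ β := hs.trans (hst.trans ht)
  have hg' : IntegrableOn g (Icc α β) := by
    rwa [integrableOn_Icc_iff_integrableOn_Ioo]
  have hcont : ContinuousOn (fun y => ∫ x in s..y, g x) (Icc α β) := by
    have := intervalIntegral.continuousOn_primitive_interval' (a := s) (b₁ := α) (b₂ := β)
      (f := g) (μ := volume)
      ((intervalIntegrable_iff_integrableOn_Icc_of_le hαβ).2 hg')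
      (by rw [uIcc_of_le hαβ]; exact ⟨hs, hst.trans ht⟩)
    rwa [uIcc_of_le hαβ] at this
  have hii : ∀ a ∈ Icc α β, ∀ b ∈ Icc α β, IntervalIntegrable g volume a b := by
    intro a ha b hb
    rw [intervalIntegrable_iff]
    exact hg'.mono_set (uIoc_subset_uIcc.trans (uIcc_subset_Icc ha hb))
  -- The cutoffs reach only interior points. The identity is therefore based at an interior point
  -- `c` and carried to the possible end points `s` and `t` by continuity of both sides.
  set c := (s + t) / 2
  have hc : c ∈ Ioo α β := ⟨by simp only [c]; linarith, by simp only [c]; linarith⟩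
  have hcI := Ioo_subset_Icc_self hc
  have hsI : s ∈ Icc α β := ⟨hs, hst.trans ht⟩
  have htI : t ∈ Icc α β := ⟨hs.trans hst, ht⟩
  have e1 : EqOn (fun y => f y - ∫ x in s..y, g x) (fun _ => f c - ∫ x in s..c, g x)
      (Ioo α β) := by
    intro y hy
    have hyI := Ioo_subset_Icc_self hy
    have : f y - f c = ∫ x in c..y, g x := by
      rcases le_total c y with h | h
      · exact inner c y hc.1 h hy.2
      · rw [intervalIntegral.integral_symm, ← inner y c hy.1 h hc.2]
        ring
    have e2 := intervalIntegral.integral_add_adjacent_intervals (hii s hsI c hcI) (hii c hcI y hyI)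
    simp only
    linarith
  have e3 := e1.of_subset_closure (hf.continuousOn.sub hcont) continuousOn_const Ioo_subset_Icc_self
    (by rw [closure_Ioo (by linarith : α < β).ne])
  have es := e3 hsI
  have et := e3 htI
  simp only [intervalIntegral.integral_same] at es et
  linarith

theorem locallyIntegrable_comp_add_right {g : ℝ → ℝ} (hg : LocallyIntegrable g) (c : ℝ) :
    LocallyIntegrable fun x => g (x + c) := by
  rw [locallyIntegrable_iff] at hg ⊢
  intro K hK
  have := (measurePreserving_add_right volume c).integrableOn_comp_preimage
    (measurableEmbedding_addRight c) (f := g) (s := (fun x => x + c) '' K)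
  rw [preimage_image_eq _ (add_left_injective c)] at this
  exact this.2 (hg _ (hK.image (continuous_add_const c)))

theorem HasWeakDeriv.congr_ae {k : ℕ} {f g f' g' : ℝ → ℝ} (h : HasWeakDeriv k f g)
    (hf : f =ᵐ[volume] f') (hg : g =ᵐ[volume] g') : HasWeakDeriv k f' g' := by
  obtain ⟨h1, h2, h3⟩ := h
  refine ⟨h1.congr hf, h2.congr hg, fun φ hφ hc => ?_⟩
  have e1 : ∫ h, f' h * iteratedDeriv k φ h = ∫ h, f h * iteratedDeriv k φ h :=
    integral_congr_ae (by filter_upwards [hf] with x hx; rw [hx])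
  have e2 : ∫ h, g' h * φ h = ∫ h, g h * φ h :=
    integral_congr_ae (by filter_upwards [hg] with x hx; rw [hx])
  rw [e1, e2, h3 φ hφ hc]

theorem derivL2Sq_congr_ae {k : ℕ} {f f' : ℝ → ℝ} (hf : f =ᵐ[volume] f') :
    derivL2Sq k f = derivL2Sq k f' := by
  have : ∀ g, HasWeakDeriv k f g ↔ HasWeakDeriv k f' g := fun g =>
    ⟨fun h => h.congr_ae hf ae_eq_rfl, fun h => h.congr_ae hf.symm ae_eq_rfl⟩
  simp only [derivL2Sq, this]

theorem HasWeakDeriv.comp_add_right {k : ℕ} {f g : ℝ → ℝ} (h : HasWeakDeriv k f g) (c : ℝ) :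
    HasWeakDeriv k (fun x => f (x + c)) fun x => g (x + c) := by
  refine ⟨locallyIntegrable_comp_add_right h.1 c, locallyIntegrable_comp_add_right h.2.1 c,
    fun φ hφ hc => ?_⟩
  have h3 := h.2.2 (fun x => φ (x - c)) (hφ.comp (by fun_prop))
    (hc.comp_homeomorph (Homeomorph.subRight c))
  rw [← integral_add_right_eq_self _ c, ← integral_add_right_eq_self (fun x => g x * φ (x - c)) c,
    iteratedDeriv_comp_sub_const] at h3
  simpa using h3

theorem HasWeakDeriv.unique {k : ℕ} {f g g' : ℝ → ℝ} (h : HasWeakDeriv k f g)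
    (h' : HasWeakDeriv k f g') : g =ᵐ[volume] g' := by
  refine ae_eq_of_integral_contDiff_smul_eq h.2.1 h'.2.1 fun φ hφ hc => ?_
  have := (h.2.2 φ hφ hc).symm.trans (h'.2.2 φ hφ hc)
  have := mul_left_cancel₀ (pow_ne_zero k (by norm_num : (-1 : ℝ) ≠ 0)) this
  simpa only [smul_eq_mul, mul_comm] using this

theorem HasWeakDeriv.ae_periodic {k : ℕ} {f g : ℝ → ℝ} (h : HasWeakDeriv k f g)
    (hf : ∀ᵐ x : ℝ, f (x + 1) = f x) : ∀ᵐ x : ℝ, g (x + 1) = g x :=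
  ((h.comp_add_right 1).congr_ae hf ae_eq_rfl).unique h

theorem HasWeakDeriv.sub_eq_integral {f g : ℝ → ℝ} (h : HasWeakDeriv 1 f g) (hf : Continuous f)
    {a b : ℝ} (hab : a ≤ b) : f b - f a = ∫ x in a..b, g x := by
  refine sub_eq_integral_of_forall_test (α := a) (β := b) hf
    ((h.2.1.integrableOn_isCompact isCompact_Icc).mono_set Ioo_subset_Icc_self)
    (fun χ hχ hc _ => ?_) le_rfl hab le_rfl
  have := h.2.2 χ hχ hc
  simpa only [iteratedDeriv_one, pow_one, neg_mul, one_mul] using this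

/-- A function which is almost everywhere `1`-periodic agrees almost everywhere with a measurable
`1`-periodic function. -/
theorem exists_measurable_periodic {g : ℝ → ℝ} (hg : AEStronglyMeasurable g)
    (hp : ∀ᵐ x : ℝ, g (x + 1) = g x) :
    ∃ g' : ℝ → ℝ, Measurable g' ∧ Function.Periodic g' 1 ∧ g =ᵐ[volume] g' := by
  -- Composing a measurable representative with the fractional part is periodic by construction. It
  -- changes the function only on a null set, because almost every point satisfies the periodicity
  -- relation for all integers at once.
  refine ⟨fun x => hg.mk g (Int.fract x), hg.stronglyMeasurable_mk.measurable.comp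
    measurable_fract, fun x => by simp, ?_⟩
  have hp' : ∀ᵐ x : ℝ, hg.mk g (x + 1) = hg.mk g x := by
    have e := (measurePreserving_add_right volume (1 : ℝ)).quasiMeasurePreserving.ae hg.ae_eq_mk
    filter_upwards [hp, hg.ae_eq_mk, e] with x h1 h2 h3
    rw [← h2, ← h1, h3]
  have hn : ∀ n : ℕ, ∀ᵐ x : ℝ, hg.mk g (x + n) = hg.mk g x := by
    intro n
    induction n with
    | zero => simp
    | succ n ih =>
      have e := (measurePreserving_add_right volume (n : ℝ)).quasiMeasurePreserving.ae hp'
      filter_upwards [ih, e] with x h1 h2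
      rw [← h1, ← h2]
      push_cast
      ring_nf
  have hz : ∀ n : ℤ, ∀ᵐ x : ℝ, hg.mk g (x + n) = hg.mk g x := by
    intro n
    obtain ⟨m, rfl | rfl⟩ := n.eq_nat_or_neg
    · simpa using hn m
    · have e := (measurePreserving_add_right volume (-m : ℝ)).quasiMeasurePreserving.ae (hn m)
      filter_upwards [e] with x h2
      simpa using h2.symm
  filter_upwards [ae_all_iff.2 hz, hg.ae_eq_mk] with x h1 h2
  rw [h2, ← h1 (-⌊x⌋)]
  congr 1
  simp [Int.fract, sub_eq_add_neg]

/-! ### Mean-square bounds for first and second differences. -/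

theorem lintegral_mul_sq_le {α : Type*} [MeasurableSpace α] (μ : Measure α)
    {f g : α → ENNReal} (hf : AEMeasurable f μ) (hg : AEMeasurable g μ) :
    (∫⁻ a, f a * g a ∂μ) ^ 2 ≤ (∫⁻ a, f a ^ 2 ∂μ) * ∫⁻ a, g a ^ 2 ∂μ := by
  have h := ENNReal.lintegral_mul_le_Lp_mul_Lq μ Real.HolderConjugate.two_two hf hg
  simp only [Pi.mul_apply, ENNReal.rpow_two] at h
  calc _ ≤ _ := pow_le_pow_left' h 2
    _ = _ := by
      rw [mul_pow, ← ENNReal.rpow_natCast, ← ENNReal.rpow_natCast, ← ENNReal.rpow_mul,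
        ← ENNReal.rpow_mul]
      norm_num

theorem ofReal_sq_integral_le {g : ℝ → ℝ} {a b : ℝ} (hab : a ≤ b)
    (hg : AEStronglyMeasurable g (volume.restrict (Ioc a b))) :
    ENNReal.ofReal ((∫ x in a..b, g x) ^ 2) ≤
      ENNReal.ofReal (b - a) * ∫⁻ x in Ioc a b, ENNReal.ofReal (g x ^ 2) := by
  have h1 := lintegral_mul_sq_le (volume.restrict (Ioc a b)) (f := fun _ => 1)
    (g := fun x => ‖g x‖ₑ) aemeasurable_const hg.enorm
  have h2 : ∀ y : ℝ, ENNReal.ofReal (y ^ 2) = ‖y‖ₑ ^ 2 := fun y => by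
    rw [← sq_abs, ENNReal.ofReal_pow (abs_nonneg _), Real.enorm_eq_ofReal_abs]
  simp only [h2, one_pow, one_mul, lintegral_one, Measure.restrict_apply_univ,
    Real.volume_Ioc] at h1 ⊢
  refine le_trans ?_ h1
  rw [intervalIntegral.integral_of_le hab]
  exact pow_le_pow_left' (enorm_integral_le_lintegral_enorm _) 2

theorem setLIntegral_Ioo_add_of_periodic {F : ℝ → ENNReal} (hF : Function.Periodic F 1) (s : ℝ) :
    ∫⁻ x in Ioo (0 : ℝ) 1, F (x + s) = ∫⁻ x in Ioo (0 : ℝ) 1, F x := by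
  have e1 : ∫⁻ x in Ioo (0 : ℝ) 1, F (x + s) = ∫⁻ x in Ioc s (s + 1), F x := by
    have := (measurePreserving_add_right volume s).setLIntegral_comp_preimage_emb
      (measurableEmbedding_addRight s) F (Ioc s (s + 1))
    rw [← this, restrict_Ioo_eq_restrict_Ioc]
    simp
  rw [e1, restrict_Ioo_eq_restrict_Ioc]
  have h0 := isAddFundamentalDomain_Ioc (zero_lt_one (α := ℝ)) 0
  rw [zero_add] at h0
  refine (isAddFundamentalDomain_Ioc zero_lt_one s).setLIntegral_eq h0 F ?_
  rintro ⟨g, hg⟩ x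
  obtain ⟨n, rfl⟩ := AddSubgroup.mem_zmultiples_iff.1 hg
  have := hF.zsmul n x
  rw [add_comm] at this
  exact this

/-- The increment of `f` has the moving integral of the second weak derivative of `f` as its first
weak derivative. -/
theorem HasWeakDeriv.shift_sub {f g : ℝ → ℝ} (h : HasWeakDeriv 2 f g) {k : ℝ} (hk : 0 ≤ k) :
    HasWeakDeriv 1 (fun x => f (x + k) - f x) fun x => ∫ s in x..x + k, g s := by
  have hgi : ∀ a b, IntervalIntegrable g volume a b := fun a b =>
    (h.2.1.integrableOn_isCompact isCompact_uIcc).intervalIntegrable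
  have hG : Continuous fun x => ∫ s in x..x + k, g s := by
    have hc := intervalIntegral.continuous_primitive hgi 0
    have : (fun x => ∫ s in x..x + k, g s) =
        fun x => (∫ s in (0 : ℝ)..(x + k), g s) - ∫ s in (0 : ℝ)..x, g s := by
      funext x
      rw [intervalIntegral.integral_interval_sub_left (hgi _ _) (hgi _ _)]
    rw [this]
    exact (hc.comp (continuous_add_const k)).sub hc
  refine ⟨(locallyIntegrable_comp_add_right h.1 k).sub h.1, hG.locallyIntegrable,
    fun φ hφ hc => ?_⟩
  have hφc : Continuous φ := hφ.continuous
  have hφi : ∀ a b, IntervalIntegrable φ volume a b := fun a b => hφc.intervalIntegrable a b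
  obtain ⟨R, hR⟩ : ∃ R : ℝ, ∀ x, φ x ≠ 0 → x ∈ Icc (-R) R := by
    obtain ⟨R, hR⟩ := hc.isCompact.isBounded.subset_closedBall 0
    refine ⟨R, fun x hx => ?_⟩
    have := hR (subset_tsupport φ hx)
    rwa [Real.closedBall_eq_Icc, zero_sub, zero_add] at this
  -- $\Phi(x)=\int_{x-k}^x\varphi$ is compactly supported, and $\Phi''=\varphi'-\varphi'(\cdot-k)$.
  -- Testing the second weak derivative with it thus yields the first derivative of the increment;
  -- Fubini then moves the moving integral from `φ` to `g`.
  set Φ : ℝ → ℝ := fun x => (∫ s in (0 : ℝ)..x, φ s) - ∫ s in (0 : ℝ)..(x - k), φ s with hΦ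
  have hΦ' : ∀ x, Φ x = ∫ s in (x - k)..x, φ s := fun x => by
    simp only [hΦ]
    rw [intervalIntegral.integral_interval_sub_left (hφi _ _) (hφi _ _)]
  have hJ : ∀ x, HasDerivAt (fun y => ∫ s in (0 : ℝ)..y, φ s) (φ x) x := fun x =>
    intervalIntegral.integral_hasDerivAt_right (hφi _ _)
      hφc.stronglyMeasurable.stronglyMeasurableAtFilter hφc.continuousAt
  have hd : ∀ x, HasDerivAt Φ (φ x - φ (x - k)) x := fun x =>
    (hJ x).sub ((hJ (x - k)).comp_sub_const x k)
  have hdΦ : deriv Φ = fun x => φ x - φ (x - k) := funext fun x => (hd x).deriv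
  have hΦs : ContDiff ℝ ∞ Φ := by
    rw [contDiff_infty_iff_deriv, hdΦ]
    exact ⟨fun x => (hd x).differentiableAt, hφ.sub (hφ.comp (by fun_prop))⟩
  have hΦ0 : ∀ x, x ∉ Icc (-R) (R + k) → Φ x = 0 := by
    intro x hx
    rw [hΦ', intervalIntegral.integral_of_le (by linarith)]
    refine setIntegral_eq_zero_of_forall_eq_zero fun s hs => ?_
    by_contra hne
    have := hR s hne
    exact hx ⟨by linarith [this.1, hs.2], by linarith [this.2, hs.1]⟩
  have hdiff : ∀ x, DifferentiableAt ℝ φ x := hφ.differentiable (by simp)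
  have hit : iteratedDeriv 2 Φ = fun x => deriv φ x - deriv φ (x - k) := by
    rw [iteratedDeriv_succ, iteratedDeriv_one, hdΦ]
    funext x
    exact ((hdiff x).hasDerivAt.sub ((hdiff (x - k)).hasDerivAt.comp_sub_const x k)).deriv
  have key := h.2.2 Φ hΦs (HasCompactSupport.intro isCompact_Icc hΦ0)
  rw [hit, neg_one_sq, one_mul] at key
  have hφd : Continuous (deriv φ) := hφ.continuous_deriv (by simp)
  have hφdc : HasCompactSupport (deriv φ) := hc.deriv
  have i1 : Integrable fun x => f x * deriv φ x := by
    simpa only [smul_eq_mul, mul_comm] using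
      h.1.integrable_smul_left_of_hasCompactSupport hφd hφdc
  have i2 : Integrable fun x => f (x + k) * deriv φ x := by
    simpa only [smul_eq_mul, mul_comm] using
      (locallyIntegrable_comp_add_right h.1 k).integrable_smul_left_of_hasCompactSupport hφd hφdc
  have i3 : Integrable fun x => f x * deriv φ (x - k) := by
    have := i2.comp_sub_right k
    simpa using this
  have e1 : ∫ x, f (x + k) * deriv φ x = ∫ x, f x * deriv φ (x - k) := by
    rw [← integral_add_right_eq_self (fun x => f x * deriv φ (x - k)) k]
    simp
  have e2 : ∫ x, (f (x + k) - f x) * deriv φ x = -∫ x, g x * Φ x := by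
    rw [← key]
    simp_rw [mul_sub, sub_mul]
    rw [integral_sub i2 i1, integral_sub i1 i3, e1]
    ring
  rw [iteratedDeriv_one, e2, pow_one, neg_one_mul, neg_inj]
  -- `g` is only locally integrable, so it is cut off for Fubini; where `φ` does not vanish, the
  -- moving interval stays inside the cutoff.
  set gR : ℝ → ℝ := (Icc (-R) (R + k)).indicator g
  have hgR : Integrable gR := (integrable_indicator_iff measurableSet_Icc).2
    (h.2.1.integrableOn_isCompact isCompact_Icc)
  set A : Set (ℝ × ℝ) := {p | p.1 < p.2 ∧ p.2 ≤ p.1 + k}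
  have hA : MeasurableSet A :=
    (measurableSet_lt measurable_fst measurable_snd).inter
      (measurableSet_le measurable_snd (measurable_fst.add_const k))
  have hint : Integrable (A.indicator fun p : ℝ × ℝ => φ p.1 * gR p.2)
      ((volume : Measure ℝ).prod volume) :=
    ((hφc.integrable_of_hasCompactSupport hc).mul_prod hgR).indicator hA
  have swap := integral_integral_swap
    (f := fun x s => A.indicator (fun p : ℝ × ℝ => φ p.1 * gR p.2) (x, s)) hint
  have l1 : ∀ x, ∫ s, A.indicator (fun p : ℝ × ℝ => φ p.1 * gR p.2) (x, s) =
      (∫ s in x..x + k, g s) * φ x := by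
    intro x
    have : ∀ s, A.indicator (fun p : ℝ × ℝ => φ p.1 * gR p.2) (x, s) =
        (Ioc x (x + k)).indicator (fun s => φ x * g s) s := by
      intro s
      by_cases hs : s ∈ Ioc x (x + k)
      · rw [indicator_of_mem (show (x, s) ∈ A from hs), indicator_of_mem hs]
        by_cases hx : φ x = 0
        · simp [hx]
        · have hx' := hR x hx
          have hs' : s ∈ Icc (-R) (R + k) :=
            ⟨by linarith [hs.1, hx'.1], by linarith [hs.2, hx'.2]⟩
          simp only [gR, indicator_of_mem hs']
      · rw [indicator_of_notMem (show (x, s) ∉ A from hs), indicator_of_notMem hs]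
    simp_rw [this]
    rw [integral_indicator measurableSet_Ioc, integral_const_mul,
      intervalIntegral.integral_of_le (by linarith), mul_comm]
  have l2 : ∀ s, ∫ x, A.indicator (fun p : ℝ × ℝ => φ p.1 * gR p.2) (x, s) = g s * Φ s := by
    intro s
    have : ∀ x, A.indicator (fun p : ℝ × ℝ => φ p.1 * gR p.2) (x, s) =
        gR s * (Ico (s - k) s).indicator φ x := by
      intro x
      by_cases hx : x ∈ Ico (s - k) s
      · rw [indicator_of_mem (show (x, s) ∈ A from ⟨hx.2, by linarith [hx.1]⟩),
          indicator_of_mem hx, mul_comm]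
      · rw [indicator_of_notMem (show (x, s) ∉ A from fun hA =>
          hx ⟨by linarith [hA.2], hA.1⟩), indicator_of_notMem hx, mul_zero]
    simp_rw [this]
    rw [integral_const_mul, integral_indicator measurableSet_Ico, integral_Ico_eq_integral_Ioo,
      ← integral_Ioc_eq_integral_Ioo, ← intervalIntegral.integral_of_le (by linarith), ← hΦ']
    by_cases hs : s ∈ Icc (-R) (R + k)
    · simp only [gR]
      rw [indicator_of_mem hs]
    · rw [hΦ0 s hs, mul_zero, mul_zero]
  simp_rw [l1, l2] at swap
  exact swap.symm

/-- Cauchy–Schwarz on $[x,x+k]$ gives one factor $k$. After Tonelli the integral over the period no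
longer depends on the shift, by periodicity, and integrating over the shifts gives the other. -/
theorem lintegral_sq_integral_shift_le {g : ℝ → ℝ} (hg : AEStronglyMeasurable g)
    (hp : ∀ᵐ x : ℝ, g (x + 1) = g x) {k : ℝ} (hk : 0 ≤ k) :
    ∫⁻ x in Ioo (0 : ℝ) 1, ENNReal.ofReal ((∫ s in x..x + k, g s) ^ 2) ≤
      ENNReal.ofReal (k ^ 2) * ∫⁻ x in Ioo (0 : ℝ) 1, ENNReal.ofReal (g x ^ 2) := by
  obtain ⟨g', hm, hper, he⟩ := exists_measurable_periodic hg hp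
  have e1 : ∀ x, ∫ s in x..x + k, g s = ∫ s in x..x + k, g' s := fun x =>
    intervalIntegral.integral_congr_ae (by filter_upwards [he] with s hs _ using hs)
  have e2 : ∫⁻ x in Ioo (0 : ℝ) 1, ENNReal.ofReal (g x ^ 2) =
      ∫⁻ x in Ioo (0 : ℝ) 1, ENNReal.ofReal (g' x ^ 2) :=
    lintegral_congr_ae (ae_restrict_of_ae (by filter_upwards [he] with s hs; rw [hs]))
  simp_rw [e1, e2]
  set F : ℝ → ENNReal := fun x => ENNReal.ofReal (g' x ^ 2)
  have hF : Measurable F := (hm.pow_const 2).ennreal_ofReal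
  have hFp : Function.Periodic F 1 := fun x => by simp only [F, hper x]
  have h1 : ∀ x, ENNReal.ofReal ((∫ s in x..x + k, g' s) ^ 2) ≤
      ENNReal.ofReal k * ∫⁻ s in Ioc 0 k, F (x + s) := by
    intro x
    refine (ofReal_sq_integral_le (by linarith) hm.aestronglyMeasurable).trans_eq ?_
    rw [add_sub_cancel_left, ← (measurePreserving_add_left volume x).setLIntegral_comp_preimage_emb
      (measurableEmbedding_addLeft x)]
    simp [F]
  calc _ ≤ ∫⁻ x in Ioo (0 : ℝ) 1, ENNReal.ofReal k * ∫⁻ s in Ioc 0 k, F (x + s) :=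
        lintegral_mono h1
    _ = ENNReal.ofReal k * ∫⁻ s in Ioc 0 k, ∫⁻ x in Ioo (0 : ℝ) 1, F (x + s) := by
        rw [lintegral_const_mul' _ _ ENNReal.ofReal_ne_top, lintegral_lintegral_swap]
        exact (hF.comp (measurable_fst.add measurable_snd)).aemeasurable
    _ = _ := by
        simp_rw [setLIntegral_Ioo_add_of_periodic hFp]
        rw [lintegral_const, Measure.restrict_apply_univ, Real.volume_Ioc, sub_zero, mul_comm
          (∫⁻ _ in _, _), ← mul_assoc, ← ENNReal.ofReal_mul hk, sq]

theorem HasWeakDeriv.lintegral_sq_sub_le {f g : ℝ → ℝ} (h : HasWeakDeriv 1 f g)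
    (hf : Continuous f) (hp : Function.Periodic f 1) {k : ℝ} (hk : 0 ≤ k) :
    ∫⁻ x in Ioo (0 : ℝ) 1, ENNReal.ofReal ((f (x + k) - f x) ^ 2) ≤
      ENNReal.ofReal (k ^ 2) * ∫⁻ x in Ioo (0 : ℝ) 1, ENNReal.ofReal (g x ^ 2) := by
  have e : ∀ x, f (x + k) - f x = ∫ s in x..x + k, g s := fun x =>
    h.sub_eq_integral hf (by linarith)
  simp_rw [e]
  exact lintegral_sq_integral_shift_le h.2.1.aestronglyMeasurable
    (h.ae_periodic (Eventually.of_forall hp)) hk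

theorem lintegral_sq_sub_le_derivL2Sq {f : ℝ → ℝ} (hf : Continuous f)
    (hp : Function.Periodic f 1) {k : ℝ} (hk : 0 < k) :
    ∫⁻ x in Ioo (0 : ℝ) 1, ENNReal.ofReal ((f (x + k) - f x) ^ 2) ≤
      ENNReal.ofReal (k ^ 2) * derivL2Sq 1 f := by
  have h0 : ENNReal.ofReal (k ^ 2) ≠ 0 := by simpa using hk.ne'
  -- Dividing by $k^2$ turns the claim into a lower bound for the infimum, which is checked for each
  -- weak derivative and is vacuous if there is none.
  rw [mul_comm, ← ENNReal.div_le_iff_le_mul (Or.inl h0) (Or.inl ENNReal.ofReal_ne_top)]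
  refine le_iInf₂ fun g hg => ?_
  rw [ENNReal.div_le_iff_le_mul (Or.inl h0) (Or.inl ENNReal.ofReal_ne_top), mul_comm]
  exact hg.lintegral_sq_sub_le hf hp hk.le

/-- Up to a shift the second difference is the difference of $x\mapsto f(x+k)-f(x)$, whose weak
derivative is the moving integral of $f''$. The first-order bound and the moving-integral bound
contribute $k^2$ each. -/
theorem lintegral_sq_second_difference_le_derivL2Sq {f : ℝ → ℝ} (hf : Continuous f)
    (hp : Function.Periodic f 1) {k : ℝ} (hk : 0 < k) :
    ∫⁻ x in Ioo (0 : ℝ) 1, ENNReal.ofReal ((f (x + k) - 2 * f x + f (x - k)) ^ 2) ≤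
      ENNReal.ofReal (k ^ 4) * derivL2Sq 2 f := by
  have h0 : ENNReal.ofReal (k ^ 4) ≠ 0 := by
    simp only [ne_eq, ENNReal.ofReal_eq_zero, not_le]
    positivity
  rw [mul_comm, ← ENNReal.div_le_iff_le_mul (Or.inl h0) (Or.inl ENNReal.ofReal_ne_top)]
  refine le_iInf₂ fun g hg => ?_
  rw [ENNReal.div_le_iff_le_mul (Or.inl h0) (Or.inl ENNReal.ofReal_ne_top), mul_comm]
  have hP := (hg.shift_sub hk.le).lintegral_sq_sub_le (by fun_prop)
    (fun x => by
      change f (x + 1 + k) - f (x + 1) = _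
      rw [add_right_comm, hp, hp]) hk.le
  have hG := lintegral_sq_integral_shift_le hg.2.1.aestronglyMeasurable
    (hg.ae_periodic (Eventually.of_forall hp)) hk.le
  have hs := setLIntegral_Ioo_add_of_periodic
    (F := fun x => ENNReal.ofReal ((f (x + k) - 2 * f x + f (x - k)) ^ 2))
    (fun x => by
      simp only
      rw [add_right_comm, hp, hp, show x + 1 - k = x - k + 1 by ring, hp]) k
  rw [← hs]
  calc _ = ∫⁻ x in Ioo (0 : ℝ) 1, ENNReal.ofReal ((f (x + k + k) - f (x + k) -
        (f (x + k) - f x)) ^ 2) := by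
        refine lintegral_congr fun x => ?_
        rw [add_sub_cancel_right]
        ring_nf
    _ ≤ _ := hP
    _ ≤ ENNReal.ofReal (k ^ 2) * (ENNReal.ofReal (k ^ 2) * _) := by gcongr
    _ = _ := by
      rw [← mul_assoc, ← ENNReal.ofReal_mul (by positivity)]
      ring_nf

/-! ### Sobolev embedding, Hölder continuity from differences, and joint continuity. -/

theorem derivL2Sq_zero {f : ℝ → ℝ} (hf : LocallyIntegrable f) :
    derivL2Sq 0 f = ∫⁻ x in Ioo (0 : ℝ) 1, ENNReal.ofReal (f x ^ 2) := by
  refine le_antisymm (iInf₂_le f ⟨hf, hf, fun φ _ _ => by simp⟩) (le_iInf₂ fun g hg => le_of_eq ?_)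
  exact lintegral_congr_ae (ae_restrict_of_ae (by
    filter_upwards [hg.ae_eq_of_zero] with x hx; rw [hx]))

/-- The Sobolev embedding of `H¹` into the bounded functions. -/
theorem ofReal_sq_le_derivL2Sq {f : ℝ → ℝ} (hf : Continuous f) (hp : Function.Periodic f 1)
    (x : ℝ) : ENNReal.ofReal (f x ^ 2) ≤ 2 * (derivL2Sq 0 f + derivL2Sq 1 f) := by
  wlog hx : x ∈ Ico (0 : ℝ) 1 generalizing x
  · have h1 : f x = f (Int.fract x) := by
      have := hp.sub_zsmul_eq ⌊x⌋ (x := x)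
      rw [zsmul_one] at this
      exact this.symm
    rw [h1]
    exact this _ ⟨Int.fract_nonneg x, Int.fract_lt_one x⟩
  rw [derivL2Sq_zero hf.locallyIntegrable]
  unfold derivL2Sq
  simp_rw [ENNReal.add_iInf, ENNReal.mul_iInf_of_ne two_ne_zero ENNReal.ofNat_ne_top]
  refine le_iInf₂ fun g hg => ?_
  have hosc : ∀ a ∈ Icc (0 : ℝ) 1, ∀ b ∈ Icc (0 : ℝ) 1, a ≤ b →
      ENNReal.ofReal ((f b - f a) ^ 2) ≤ ∫⁻ y in Ioo (0 : ℝ) 1, ENNReal.ofReal (g y ^ 2) := by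
    intro a ha b hb hab
    rw [hg.sub_eq_integral hf hab]
    refine (ofReal_sq_integral_le hab hg.2.1.aestronglyMeasurable.restrict).trans ?_
    calc _ ≤ 1 * ∫⁻ y in Ioc 0 1, ENNReal.ofReal (g y ^ 2) := by
          refine mul_le_mul' ?_ (lintegral_mono_set (Ioc_subset_Ioc ha.1 hb.2))
          rw [ENNReal.ofReal_le_one]
          linarith [ha.1, hb.2]
      _ = _ := by rw [one_mul, restrict_Ioo_eq_restrict_Ioc]
  have hpt : ∀ y ∈ Ioo (0 : ℝ) 1, ENNReal.ofReal (f x ^ 2) ≤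
      2 * (ENNReal.ofReal (f y ^ 2) + ∫⁻ y in Ioo (0 : ℝ) 1, ENNReal.ofReal (g y ^ 2)) := by
    intro y hy
    have hxI := Ico_subset_Icc_self hx
    have hyI := Ioo_subset_Icc_self hy
    have h1 : ENNReal.ofReal ((f x - f y) ^ 2) ≤
        ∫⁻ y in Ioo (0 : ℝ) 1, ENNReal.ofReal (g y ^ 2) := by
      rcases le_total x y with hxy | hxy
      · rw [show (f x - f y) ^ 2 = (f y - f x) ^ 2 by ring]
        exact hosc x hxI y hyI hxy
      · exact hosc y hyI x hxI hxy
    calc ENNReal.ofReal (f x ^ 2) ≤ ENNReal.ofReal (2 * (f y ^ 2 + (f x - f y) ^ 2)) :=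
          ENNReal.ofReal_le_ofReal (by nlinarith [sq_nonneg (f x - 2 * f y)])
      _ = 2 * (ENNReal.ofReal (f y ^ 2) + ENNReal.ofReal ((f x - f y) ^ 2)) := by
          rw [ENNReal.ofReal_mul zero_le_two, ENNReal.ofReal_add (sq_nonneg _) (sq_nonneg _),
            ENNReal.ofReal_ofNat]
      _ ≤ _ := by gcongr
  calc ENNReal.ofReal (f x ^ 2) = ∫⁻ _ in Ioo (0 : ℝ) 1, ENNReal.ofReal (f x ^ 2) := by simp
    _ ≤ ∫⁻ y in Ioo (0 : ℝ) 1, 2 * (ENNReal.ofReal (f y ^ 2) +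
        ∫⁻ y in Ioo (0 : ℝ) 1, ENNReal.ofReal (g y ^ 2)) :=
        setLIntegral_mono' measurableSet_Ioo hpt
    _ = _ := by
        rw [lintegral_const_mul' _ _ ENNReal.ofNat_ne_top,
          lintegral_add_left (f := fun y => ENNReal.ofReal (f y ^ 2))
            (hf.pow 2).measurable.ennreal_ofReal]
        simp

/-- A continuous function whose increments are bounded in mean square by the step size is Hölder
continuous with exponent `1/2`. -/
theorem sq_sub_le_of_lintegral_sq_sub_le {f : ℝ → ℝ} (hf : Continuous f) {B : ℝ} (hB : 0 ≤ B)
    (h : ∀ k : ℝ, 0 < k → ∫⁻ x in Ioo (0 : ℝ) 1, ENNReal.ofReal ((f (x + k) - f x) ^ 2) ≤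
      ENNReal.ofReal (k ^ 2 * B)) {x y : ℝ} (hx : x ∈ Icc (0 : ℝ) 1) (hy : y ∈ Icc (0 : ℝ) 1) :
    (f x - f y) ^ 2 ≤ B * |x - y| := by
  wlog hxy : x ≤ y generalizing x y
  · rw [abs_sub_comm, show (f x - f y) ^ 2 = (f y - f x) ^ 2 by ring]
    exact this hy hx (le_of_not_ge hxy)
  rw [abs_sub_comm, abs_of_nonneg (by linarith)]
  have hi : ∀ a b, IntervalIntegrable f volume a b := fun a b => hf.intervalIntegrable a b
  -- Averages over windows of length `r` replace point values: the difference of two window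
  -- integrals is $\int_x^y(f(s+r)-f(s))\,ds$, to which Cauchy–Schwarz and the mean-square bound
  -- apply. The bound does not depend on `r`, and $r\to0$ recovers the point values.
  have main : ∀ r : ℝ, 0 < r →
      (r⁻¹ * (∫ s in x..x + r, f s) - r⁻¹ * ∫ s in y..y + r, f s) ^ 2 ≤ B * (y - x) := by
    intro r hr
    have e : (∫ s in y..y + r, f s) - (∫ s in x..x + r, f s) =
        ∫ s in x..y, (f (s + r) - f s) := by
      rw [intervalIntegral.integral_sub
        ((by fun_prop : Continuous fun s => f (s + r)).intervalIntegrable _ _)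
        (hi _ _), intervalIntegral.integral_comp_add_right]
      have e1 := intervalIntegral.integral_add_adjacent_intervals (hi x y) (hi y (y + r))
      have e2 := intervalIntegral.integral_add_adjacent_intervals (hi x (x + r)) (hi (x + r) (y + r))
      linarith
    have h1 := (ofReal_sq_integral_le (g := fun s => f (s + r) - f s) hxy
      (by fun_prop : Continuous fun s => f (s + r) - f s).aestronglyMeasurable)
    have h2 : ∫⁻ s in Ioc x y, ENNReal.ofReal ((f (s + r) - f s) ^ 2) ≤
        ENNReal.ofReal (r ^ 2 * B) := by
      refine (lintegral_mono_set (Ioc_subset_Ioc hx.1 hy.2)).trans ?_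
      rw [← restrict_Ioo_eq_restrict_Ioc]
      exact h r hr
    have h3 : (∫ s in x..y, (f (s + r) - f s)) ^ 2 ≤ (y - x) * (r ^ 2 * B) := by
      rw [← ENNReal.ofReal_le_ofReal_iff (mul_nonneg (by linarith) (by positivity)),
        ENNReal.ofReal_mul (by linarith : (0 : ℝ) ≤ y - x)]
      exact h1.trans (mul_le_mul' le_rfl h2)
    calc _ = (r⁻¹) ^ 2 * (∫ s in x..y, (f (s + r) - f s)) ^ 2 := by rw [← e]; ring
      _ ≤ (r⁻¹) ^ 2 * ((y - x) * (r ^ 2 * B)) := by gcongr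
      _ = _ := by field_simp
  have hlim : ∀ c, Tendsto (fun r : ℝ => r⁻¹ * ∫ s in c..c + r, f s) (𝓝[>] 0) (𝓝 (f c)) := by
    intro c
    have hd : HasDerivAt (fun u => ∫ s in c..u, f s) (f c) c :=
      intervalIntegral.integral_hasDerivAt_right (hi _ _)
        hf.stronglyMeasurable.stronglyMeasurableAtFilter hf.continuousAt
    have := hd.tendsto_slope_zero_right
    simpa using this
  refine le_of_tendsto (((hlim x).sub (hlim y)).pow 2) ?_
  filter_upwards [self_mem_nhdsWithin] with r hr using main r hr

theorem sobolevNorm_sq (m : ℕ) (f : ℝ → ℝ) :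
    sobolevNorm m f ^ 2 = ∑ k ∈ Finset.range (m + 1), derivL2Sq k f := by
  rw [sobolevNorm, ← ENNReal.rpow_natCast, ← ENNReal.rpow_mul]
  norm_num

theorem ofReal_sq_le_sobolevNorm_sq {f : ℝ → ℝ} (hf : Continuous f)
    (hp : Function.Periodic f 1) (x : ℝ) :
    ENNReal.ofReal (f x ^ 2) ≤ 2 * sobolevNorm 1 f ^ 2 := by
  rw [sobolevNorm_sq, Finset.sum_range_succ, Finset.sum_range_one]
  exact ofReal_sq_le_derivL2Sq hf hp x

theorem periodic_of_ae {f : ℝ → ℝ} (hf : Continuous f) (hp : ∀ᵐ x : ℝ, f (x + 1) = f x) :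
    Function.Periodic f 1 := fun x =>
  congrFun (Continuous.ae_eq_iff_eq volume (hf.comp (continuous_add_const 1)) hf |>.1 hp) x

/-- Continuity in time with values in `H¹` gives joint continuity. -/
theorem continuous_uncurry_of_tendsto_sobolevNorm {T : ℝ} (hT : 0 ≤ T) {w : ℝ → ℝ → ℝ}
    (hc : ∀ t ∈ Icc 0 T, Continuous (w t)) (hp : ∀ t ∈ Icc 0 T, Function.Periodic (w t) 1)
    (hs : ∀ t₀ ∈ Icc 0 T, Tendsto (fun t => sobolevNorm 1 fun h => w t h - w t₀ h)
      (𝓝[Icc 0 T] t₀) (𝓝 0)) :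
    Continuous fun p : ℝ × ℝ => w (projIcc 0 T hT p.1) p.2 := by
  rw [continuous_iff_continuousAt]
  rintro ⟨t₀, h₀⟩
  -- Freezing time outside $[0,T]$ makes the function continuous on the whole plane. The Sobolev
  -- embedding turns $H^1$ convergence in time into uniform convergence in space.
  set c : ℝ → ℝ := fun t => projIcc 0 T hT t with hcdef
  have hcI : ∀ t, c t ∈ Icc 0 T := fun t => (projIcc 0 T hT t).2
  have hcc : Continuous c := continuous_subtype_val.comp continuous_projIcc
  have h1 : Tendsto c (𝓝 t₀) (𝓝[Icc 0 T] (c t₀)) :=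
    tendsto_nhdsWithin_iff.2 ⟨hcc.tendsto t₀, Eventually.of_forall hcI⟩
  have h2 : Tendsto (fun p : ℝ × ℝ => ENNReal.ofReal ((w (c p.1) p.2 - w (c t₀) p.2) ^ 2))
      (𝓝 (t₀, h₀)) (𝓝 0) := by
    have h3 : Tendsto (fun p : ℝ × ℝ =>
        2 * (sobolevNorm 1 fun h => w (c p.1) h - w (c t₀) h) ^ 2) (𝓝 (t₀, h₀)) (𝓝 0) := by
      have := ((hs _ (hcI t₀)).comp h1).comp (continuous_fst.tendsto (t₀, h₀))
      have := ENNReal.Tendsto.const_mul (a := 2) (ENNReal.Tendsto.pow (n := 2) this)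
        (Or.inr ENNReal.ofNat_ne_top)
      simpa using this
    refine tendsto_of_tendsto_of_tendsto_of_le_of_le tendsto_const_nhds h3 (fun _ => zero_le)
      fun p => ?_
    exact ofReal_sq_le_sobolevNorm_sq (f := fun h => w (c p.1) h - w (c t₀) h)
      ((hc _ (hcI _)).sub (hc _ (hcI _)))
      ((hp _ (hcI _)).sub (hp _ (hcI _))) p.2
  have h4 : Tendsto (fun p : ℝ × ℝ => w (c p.1) p.2 - w (c t₀) p.2) (𝓝 (t₀, h₀)) (𝓝 0) := by
    have := (ENNReal.tendsto_toReal ENNReal.zero_ne_top).comp h2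
    simp only [Function.comp_def, ENNReal.toReal_ofReal (sq_nonneg _), ENNReal.toReal_zero] at this
    have := this.sqrt
    simp only [Real.sqrt_sq_eq_abs, Real.sqrt_zero] at this
    exact (tendsto_zero_iff_abs_tendsto_zero _).2 this
  have h5 : Tendsto (fun p : ℝ × ℝ => w (c t₀) p.2) (𝓝 (t₀, h₀)) (𝓝 (w (c t₀) h₀)) :=
    ((hc _ (hcI t₀)).tendsto h₀).comp (continuous_snd.tendsto (t₀, h₀))
  have := h4.add h5
  simp only [sub_add_cancel, zero_add] at this
  exact this

/-! ### Integrating the time derivative, and a chain rule for functionals. -/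

theorem restrict_Ioc_prod_Ioo (a b c d : ℝ) :
    (volume : Measure (ℝ × ℝ)).restrict (Ioc a b ×ˢ Ioo c d) =
      (volume.restrict (Ioc a b)).prod (volume.restrict (Ioo c d)) := by
  rw [Measure.prod_restrict, Measure.volume_eq_prod]

theorem restrict_Ioc_prod_Ioo' (a b c d : ℝ) :
    (volume : Measure (ℝ × ℝ)).restrict (Ioc a b ×ˢ Ioo c d) =
      volume.restrict (Ioo a b ×ˢ Ioo c d) := by
  rw [Measure.volume_eq_prod, ← Measure.prod_restrict, ← Measure.prod_restrict,
    restrict_Ioo_eq_restrict_Ioc (a := a)]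

/-- A function which is continuous in space-time and has an integrable weak time derivative is, in
the mean over a period, a primitive of this derivative. -/
theorem HasWeakTimeDerivOn.integral_sub_mul {T : ℝ} {U : ℝ → ℝ → ℝ}
    {u v : ℝ × ℝ → ℝ} (h : HasWeakTimeDerivOn (Ioo 0 T ×ˢ univ) u v)
    (hU : Continuous fun p : ℝ × ℝ => U p.1 p.2) (huU : ∀ t ∈ Ioo 0 T, ∀ x, u (t, x) = U t x)
    (hv : IntegrableOn v (Ioc 0 T ×ˢ Ioo 0 1)) {s t : ℝ} (hs : 0 ≤ s) (hst : s ≤ t) (ht : t ≤ T)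
    {ψ : ℝ → ℝ} (hψ : Continuous ψ) :
    ∫ x in Ioo (0 : ℝ) 1, (U t x - U s x) * ψ x =
      ∫ p in Ioc s t ×ˢ Ioo 0 1, v p * ψ p.2 := by
  have hst' : Ioc s t ⊆ Ioc 0 T := Ioc_subset_Ioc hs ht
  have hv0 : Integrable v ((volume.restrict (Ioc 0 T)).prod (volume.restrict (Ioo 0 1))) := by
    rw [← restrict_Ioc_prod_Ioo]
    exact hv
  have hv1 : Integrable v ((volume.restrict (Ioc s t)).prod (volume.restrict (Ioo 0 1))) := by
    rw [← restrict_Ioc_prod_Ioo]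
    exact hv.mono_set (prod_mono_left hst')
  have hvψ : ∀ (μ : Measure ℝ) [SFinite μ] (θ : ℝ → ℝ),
      Integrable v (μ.prod (volume.restrict (Ioo 0 1))) → Continuous θ →
      Integrable (fun p : ℝ × ℝ => v p * θ p.2) (μ.prod (volume.restrict (Ioo 0 1))) := by
    intro μ _ θ hvμ hθ
    obtain ⟨M, hM⟩ := (isCompact_Icc (a := (0 : ℝ)) (b := 1)).exists_bound_of_continuousOn
      hθ.continuousOn
    refine hvμ.mul_bdd (c := M) (hθ.comp continuous_snd).aestronglyMeasurable ?_
    have : ∀ᵐ y ∂(volume.restrict (Ioo (0 : ℝ) 1)), ‖θ y‖ ≤ M := by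
      filter_upwards [ae_restrict_mem measurableSet_Ioo] with y hy
      exact hM y (Ioo_subset_Icc_self hy)
    exact Measure.quasiMeasurePreserving_snd.ae this
  have hUs : ∀ τ, Continuous (U τ) := fun τ => hU.comp (by fun_prop : Continuous fun x => (τ, x))
  -- smooth test functions
  have smooth : ∀ θ : ℝ → ℝ, ContDiff ℝ ∞ θ → HasCompactSupport θ → tsupport θ ⊆ Ioo 0 1 →
      ∫ x in Ioo (0 : ℝ) 1, (U t x - U s x) * θ x =
        ∫ p in Ioc s t ×ˢ Ioo 0 1, v p * θ p.2 := by
    intro θ hθ hθc hθs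
    have hθ0 : ∀ x, x ∉ Ioo (0 : ℝ) 1 → θ x = 0 := fun x hx =>
      image_eq_zero_of_notMem_tsupport fun hx' => hx (hθs hx')
    -- Product test functions $\chi(t)\theta(x)$ show that the pairing of `U` with `θ` has the weak
    -- derivative `g` in time; the one-dimensional result then applies up to the end points $0$ and
    -- $T$.
    set f : ℝ → ℝ := fun τ => ∫ x in (0 : ℝ)..1, U τ x * θ x
    set g : ℝ → ℝ := fun τ => ∫ x in Ioo (0 : ℝ) 1, v (τ, x) * θ x
    have hf : Continuous f :=
      intervalIntegral.continuous_parametric_intervalIntegral_of_continuous'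
        (hU.mul (hθ.continuous.comp continuous_snd)) 0 1
    have hfe : ∀ τ, f τ = ∫ x, U τ x * θ x := fun τ => by
      simp only [f]
      rw [intervalIntegral.integral_of_le zero_le_one, ← restrict_Ioo_eq_restrict_Ioc]
      refine setIntegral_eq_integral_of_forall_compl_eq_zero fun x hx => ?_
      rw [hθ0 x hx, mul_zero]
    have hg : IntegrableOn g (Ioo 0 T) := by
      rw [← integrableOn_Ioc_iff_integrableOn_Ioo]
      exact (hvψ _ θ hv0 hθ.continuous).integral_prod_left
    have H : ∀ χ : ℝ → ℝ, ContDiff ℝ ∞ χ → HasCompactSupport χ → tsupport χ ⊆ Ioo 0 T →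
        ∫ τ, f τ * deriv χ τ = -∫ τ, g τ * χ τ := by
      intro χ hχ hχc hχs
      have hχ0 : ∀ τ, τ ∉ Ioo 0 T → χ τ = 0 := fun x hx =>
        image_eq_zero_of_notMem_tsupport fun hx' => hx (hχs hx')
      have hsupp : tsupport (fun p : ℝ × ℝ => χ p.1 * θ p.2) ⊆ tsupport χ ×ˢ tsupport θ := by
        refine closure_minimal (fun p hp => ?_)
          ((isClosed_tsupport χ).prod (isClosed_tsupport θ))
        exact ⟨subset_tsupport χ (left_ne_zero_of_mul hp),
          subset_tsupport θ (right_ne_zero_of_mul hp)⟩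
      have key := h.2.2 (fun p => χ p.1 * θ p.2)
        ((hχ.comp contDiff_fst).mul (hθ.comp contDiff_snd))
        ((hχc.isCompact.prod hθc.isCompact).of_isClosed_subset (isClosed_tsupport _) hsupp)
        (hsupp.trans (prod_mono hχs (subset_univ _)))
      have hder : ∀ p : ℝ × ℝ, deriv (fun τ => χ τ * θ p.2) p.1 = deriv χ p.1 * θ p.2 := fun p =>
        deriv_mul_const (hχ.differentiable (by simp) p.1) (θ p.2)
      simp only [hder] at key
      have hχd : Continuous (deriv χ) := hχ.continuous_deriv (by simp)
      have huU' : ∀ p : ℝ × ℝ, u p * (deriv χ p.1 * θ p.2) =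
          U p.1 p.2 * (deriv χ p.1 * θ p.2) := by
        intro p
        by_cases h1 : p.1 ∈ Ioo 0 T
        · rw [← huU p.1 h1]
        · have : deriv χ p.1 = 0 := by
            by_contra hne
            exact h1 (hχs (support_deriv_subset hne))
          rw [this, zero_mul, mul_zero, mul_zero]
      simp only [huU'] at key
      have l : ∫ p : ℝ × ℝ, U p.1 p.2 * (deriv χ p.1 * θ p.2) = ∫ τ, f τ * deriv χ τ := by
        have hi : Integrable (fun p : ℝ × ℝ => U p.1 p.2 * (deriv χ p.1 * θ p.2))
            ((volume : Measure ℝ).prod volume) := by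
          refine Continuous.integrable_of_hasCompactSupport (hU.mul
            ((hχd.comp continuous_fst).mul (hθ.continuous.comp continuous_snd))) ?_
          refine HasCompactSupport.intro (hχc.isCompact.prod hθc.isCompact) fun p hp => ?_
          by_cases h1 : p.1 ∈ tsupport χ
          · have h2 : p.2 ∉ tsupport θ := fun h2 => hp ⟨h1, h2⟩
            rw [image_eq_zero_of_notMem_tsupport h2, mul_zero, mul_zero]
          · have : deriv χ p.1 = 0 := by
              by_contra hne
              exact h1 (support_deriv_subset hne)
            rw [this, zero_mul, mul_zero]
        rw [Measure.volume_eq_prod, integral_prod _ hi]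
        refine integral_congr_ae (Eventually.of_forall fun τ => ?_)
        simp only [hfe]
        rw [← integral_mul_const]
        refine integral_congr_ae (Eventually.of_forall fun x => ?_)
        simp only
        ring
      have r : ∫ p : ℝ × ℝ, v p * (χ p.1 * θ p.2) = ∫ τ, g τ * χ τ := by
        have hr : ∫ p in Ioc 0 T ×ˢ Ioo 0 1, v p * (χ p.1 * θ p.2) =
            ∫ p : ℝ × ℝ, v p * (χ p.1 * θ p.2) := by
          refine setIntegral_eq_integral_of_forall_compl_eq_zero fun p hp => ?_
          by_cases h1 : p.1 ∈ Ioo 0 T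
          · rw [hθ0 p.2 fun h2 => hp ⟨Ioo_subset_Ioc_self h1, h2⟩, mul_zero, mul_zero]
          · rw [hχ0 p.1 h1, zero_mul, mul_zero]
        have hr2 : ∫ τ in Ioc 0 T, g τ * χ τ = ∫ τ, g τ * χ τ := by
          refine setIntegral_eq_integral_of_forall_compl_eq_zero fun τ hτ => ?_
          rw [hχ0 τ fun h1 => hτ (Ioo_subset_Ioc_self h1), mul_zero]
        obtain ⟨M, hM⟩ := hχc.exists_bound_of_continuous hχ.continuous
        have hi : Integrable (fun p : ℝ × ℝ => v p * (χ p.1 * θ p.2))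
            ((volume.restrict (Ioc 0 T)).prod (volume.restrict (Ioo 0 1))) := by
          have := (hvψ _ θ hv0 hθ.continuous).bdd_mul (c := M) (f := fun p : ℝ × ℝ => χ p.1)
            (hχ.continuous.comp continuous_fst).aestronglyMeasurable
            (Eventually.of_forall fun p => hM p.1)
          refine this.congr (Eventually.of_forall fun p => ?_)
          simp only
          ring
        rw [← hr, ← hr2, restrict_Ioc_prod_Ioo, integral_prod _ hi]
        refine integral_congr_ae (Eventually.of_forall fun τ => ?_)
        simp only [g]
        rw [← integral_mul_const]
        refine integral_congr_ae (Eventually.of_forall fun x => ?_)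
        simp only
        ring
      rw [← l, ← r, key]
    have e := sub_eq_integral_of_forall_test hf hg H hs hst ht
    have e1 : f t - f s = ∫ x in Ioo (0 : ℝ) 1, (U t x - U s x) * θ x := by
      have hi : ∀ τ, IntervalIntegrable (fun x => U τ x * θ x) volume 0 1 := fun τ =>
        ((hUs τ).mul hθ.continuous).intervalIntegrable _ _
      simp only [f]
      rw [← intervalIntegral.integral_sub (hi t) (hi s), intervalIntegral.integral_of_le zero_le_one, ← restrict_Ioo_eq_restrict_Ioc]
      simp only [sub_mul]
    rw [← e1, e, intervalIntegral.integral_of_le hst, restrict_Ioc_prod_Ioo,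
      integral_prod _ (hvψ _ θ hv1 hθ.continuous)]
  -- general test functions
  set b : ℝ → ℝ := fun x => ∫ τ in Ioc s t, v (τ, x)
  have hb : IntegrableOn b (Ioo 0 1) := hv1.integral_prod_right
  have hswap : ∀ θ : ℝ → ℝ, Continuous θ → ∫ p in Ioc s t ×ˢ Ioo 0 1, v p * θ p.2 =
      ∫ x in Ioo (0 : ℝ) 1, b x * θ x := by
    intro θ hθ
    rw [restrict_Ioc_prod_Ioo, integral_prod_symm _ (hvψ _ θ hv1 hθ)]
    refine integral_congr_ae (Eventually.of_forall fun x => ?_)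
    simp only [b]
    rw [← integral_mul_const]
  have hd : IntegrableOn (fun x => U t x - U s x) (Ioo 0 1) :=
    (((hUs t).sub (hUs s)).integrableOn_Icc).mono_set Ioo_subset_Icc_self
  -- Test functions supported inside the period already identify the increment with `b` almost
  -- everywhere, so `ψ` need not vanish at the end points.
  have hzero : ∀ᵐ x : ℝ, x ∈ Ioo (0 : ℝ) 1 → (U t x - U s x) - b x = 0 := by
    refine isOpen_Ioo.ae_eq_zero_of_integral_contDiff_smul_eq_zero
      (IntegrableOn.locallyIntegrableOn (hd.sub hb)) fun θ hθ hθc hθs => ?_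
    have hθ0 : ∀ x, x ∉ Ioo (0 : ℝ) 1 → θ x = 0 := fun x hx =>
      image_eq_zero_of_notMem_tsupport fun hx' => hx (hθs hx')
    have e := smooth θ hθ hθc hθs
    rw [hswap θ hθ.continuous] at e
    obtain ⟨M, hM⟩ := hθc.exists_bound_of_continuous hθ.continuous
    have i1 := hd.mul_bdd (c := M) hθ.continuous.aestronglyMeasurable (Eventually.of_forall hM)
    have i2 := hb.mul_bdd (c := M) hθ.continuous.aestronglyMeasurable (Eventually.of_forall hM)
    rw [← setIntegral_eq_integral_of_forall_compl_eq_zero (s := Ioo (0 : ℝ) 1)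
      fun x hx => by rw [hθ0 x hx, zero_smul]]
    calc _ = ∫ x in Ioo (0 : ℝ) 1, ((U t x - U s x) * θ x - b x * θ x) := by
          refine integral_congr_ae (Eventually.of_forall fun x => ?_)
          simp only [smul_eq_mul]
          ring
      _ = 0 := by rw [integral_sub i1 i2, e, sub_self]
  rw [hswap ψ hψ]
  refine setIntegral_congr_ae measurableSet_Ioo ?_
  filter_upwards [hzero] with x hx hxI
  rw [sub_eq_zero.1 (hx hxI)]

/-- Chain rule: if the increments of `q` are those of `U` integrated against a continuous kernel,
then `q` is a primitive of the time derivative of `U` integrated against the diagonal of the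
kernel. -/
theorem sub_eq_integral_of_increment {U : ℝ → ℝ → ℝ} {v : ℝ × ℝ → ℝ} {a b : ℝ} (hab : a ≤ b)
    (hv : IntegrableOn v (Ioc a b ×ˢ Ioo 0 1))
    (hU : ∀ s t, a ≤ s → s ≤ t → t ≤ b → ∀ ψ : ℝ → ℝ, Continuous ψ →
      ∫ x in Ioo (0 : ℝ) 1, (U t x - U s x) * ψ x = ∫ p in Ioc s t ×ˢ Ioo 0 1, v p * ψ p.2)
    {K : ℝ → ℝ → ℝ → ℝ} (hK : Continuous fun p : ℝ × ℝ × ℝ => K p.1 p.2.1 p.2.2) {q : ℝ → ℝ}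
    (hq : ∀ s t, a ≤ s → s ≤ t → t ≤ b →
      q t - q s = ∫ x in Ioo (0 : ℝ) 1, (U t x - U s x) * K s t x) :
    q b - q a = ∫ p in Ioc a b ×ˢ Ioo 0 1, v p * K p.1 p.1 p.2 := by
  have hcpt := isCompact_Icc (a := a) (b := b)
  have hcpt1 := isCompact_Icc (a := (0 : ℝ)) (b := 1)
  have hsub : ∀ {s t}, a ≤ s → t ≤ b → Ioc s t ×ˢ Ioo (0 : ℝ) 1 ⊆ Ioc a b ×ˢ Ioo 0 1 :=
    fun hs ht => prod_mono_left (Ioc_subset_Ioc hs ht)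
  have hmeas : ∀ s t : ℝ, MeasurableSet (Ioc s t ×ˢ Ioo (0 : ℝ) 1) := fun s t =>
    measurableSet_Ioc.prod measurableSet_Ioo
  have hbdd : ∀ κ : ℝ × ℝ → ℝ, Continuous κ →
      IntegrableOn (fun p => v p * κ p) (Ioc a b ×ˢ Ioo 0 1) := by
    intro κ hκ
    obtain ⟨M, hM⟩ := (hcpt.prod hcpt1).exists_bound_of_continuousOn hκ.continuousOn
    refine hv.mul_bdd (c := M) hκ.aestronglyMeasurable ?_
    filter_upwards [ae_restrict_mem (hmeas a b)] with p hp
    exact hM p ⟨Ioc_subset_Icc_self hp.1, Ioo_subset_Icc_self hp.2⟩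
  have hva : IntegrableOn (fun p => |v p|) (Ioc a b ×ˢ Ioo 0 1) := hv.abs
  have hdiag : Continuous fun p : ℝ × ℝ => K p.1 p.1 p.2 :=
    hK.comp (by fun_prop : Continuous fun p : ℝ × ℝ => (p.1, p.1, p.2))
  have claim : ∀ ε : ℝ, 0 < ε →
      |q b - q a - ∫ p in Ioc a b ×ˢ Ioo 0 1, v p * K p.1 p.1 p.2| ≤
        ε * ∫ p in Ioc a b ×ˢ Ioo 0 1, |v p| := by
    intro ε hε
    -- On a time step shorter than `δ`, the kernel $K(s,t,\cdot)$ differs from its diagonal value by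
    -- less than `ε`, so the errors add up to at most $\varepsilon\int|v|$. No derivative of `q` in
    -- time is required.
    have huc := (hcpt.prod (hcpt.prod hcpt1)).uniformContinuousOn_of_continuous hK.continuousOn
    obtain ⟨δ, hδ, hKδ⟩ := Metric.uniformContinuousOn_iff.1 huc ε hε
    have step : ∀ s t, a ≤ s → s ≤ t → t ≤ b → t - s < δ →
        |q t - q s - ∫ p in Ioc s t ×ˢ Ioo 0 1, v p * K p.1 p.1 p.2| ≤
          ε * ∫ p in Ioc s t ×ˢ Ioo 0 1, |v p| := by
      intro s t hs hst ht hδ'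
      have hc : Continuous (K s t) := hK.comp (by fun_prop : Continuous fun x => (s, t, x))
      rw [hq s t hs hst ht, hU s t hs hst ht _ hc, ← integral_sub
        ((hbdd (fun p => K s t p.2) (hc.comp continuous_snd)).mono_set (hsub hs ht))
        ((hbdd _ hdiag).mono_set (hsub hs ht)), ← integral_const_mul, ← Real.norm_eq_abs]
      refine norm_integral_le_of_norm_le ((hv.mono_set (hsub hs ht)).abs.const_mul ε) ?_
      filter_upwards [ae_restrict_mem (hmeas s t)] with p hp
      rw [← mul_sub, norm_mul, mul_comm, Real.norm_eq_abs (v p)]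
      refine mul_le_mul_of_nonneg_right (le_of_lt ?_) (abs_nonneg _)
      rw [← dist_eq_norm]
      have hsI : s ∈ Icc a b := ⟨hs, hst.trans ht⟩
      have htI : t ∈ Icc a b := ⟨hs.trans hst, ht⟩
      have hpI : p.1 ∈ Icc a b := ⟨hs.trans hp.1.1.le, hp.1.2.trans ht⟩
      have hp2 := Ioo_subset_Icc_self hp.2
      refine hKδ (s, t, p.2) ⟨hsI, htI, hp2⟩ (p.1, p.1, p.2) ⟨hpI, hpI, hp2⟩ ?_
      rw [Prod.dist_eq, Prod.dist_eq, dist_self, Real.dist_eq, Real.dist_eq]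
      refine max_lt ?_ (max_lt ?_ hδ)
      · rw [abs_sub_comm, abs_of_nonneg (by linarith [hp.1.1])]
        linarith [hp.1.2]
      · rw [abs_of_nonneg (by linarith [hp.1.2])]
        linarith [hp.1.1]
    -- Cut $[a,b]$ into $N+1$ equal steps; the extra one keeps the divisor positive, and the step
    -- length stays below `δ`.
    obtain ⟨N, hN⟩ := exists_nat_gt ((b - a) / δ)
    set N' : ℝ := (N : ℝ) + 1 with hN'
    have hN0 : 0 < N' := by positivity
    set r := (b - a) / N' with hr
    have hr0 : 0 ≤ r := div_nonneg (by linarith) hN0.le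
    have hrδ : r < δ := by
      rw [hr, div_lt_comm₀ hN0 hδ]
      linarith
    have ind : ∀ n : ℕ, (n : ℝ) ≤ N' →
        |q (a + n * r) - q a - ∫ p in Ioc a (a + n * r) ×ˢ Ioo 0 1, v p * K p.1 p.1 p.2| ≤
          ε * ∫ p in Ioc a (a + n * r) ×ˢ Ioo 0 1, |v p| := by
      intro n
      induction n with
      | zero => intro _; simp
      | succ n ih =>
        intro hn
        push_cast at hn ⊢
        have ih' := ih (by linarith)
        set s := a + n * r with hs
        have hst : a + ((n : ℝ) + 1) * r = s + r := by rw [hs]; ring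
        have has : a ≤ s := by
          have : 0 ≤ (n : ℝ) * r := by positivity
          linarith
        have htb : s + r ≤ b := by
          rw [← hst]
          have : ((n : ℝ) + 1) * r ≤ N' * r := mul_le_mul_of_nonneg_right hn hr0
          have h2 : N' * r = b - a := by rw [hr]; field_simp
          linarith
        rw [hst]
        have hstep := step s (s + r) has (by linarith) htb (by linarith)
        have hdisj : Disjoint (Ioc a s ×ˢ Ioo (0 : ℝ) 1) (Ioc s (s + r) ×ˢ Ioo (0 : ℝ) 1) :=
          Disjoint.set_prod_left (Ioc_disjoint_Ioc_of_le le_rfl) _ _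
        have hun : Ioc a (s + r) ×ˢ Ioo (0 : ℝ) 1 =
            Ioc a s ×ˢ Ioo (0 : ℝ) 1 ∪ Ioc s (s + r) ×ˢ Ioo (0 : ℝ) 1 := by
          rw [← union_prod, Ioc_union_Ioc_eq_Ioc has (by linarith)]
        have hsb : s ≤ b := by linarith
        rw [hun, setIntegral_union hdisj (hmeas _ _) ((hbdd _ hdiag).mono_set (hsub le_rfl hsb))
          ((hbdd _ hdiag).mono_set (hsub has htb)), setIntegral_union hdisj (hmeas _ _)
          (hva.mono_set (hsub le_rfl hsb)) (hva.mono_set (hsub has htb)), mul_add]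
        refine le_trans ?_ (add_le_add ih' hstep)
        refine le_trans (le_of_eq ?_) (abs_add_le _ _)
        congr 1
        ring
    have := ind (N + 1) (by push_cast; exact le_rfl)
    have e : a + ((N + 1 : ℕ) : ℝ) * r = b := by
      rw [hr]
      push_cast
      rw [← hN']
      field_simp
      ring
    rwa [e] at this
  have hV : 0 ≤ ∫ p in Ioc a b ×ˢ Ioo 0 1, |v p| := integral_nonneg fun _ => abs_nonneg _
  have : |q b - q a - ∫ p in Ioc a b ×ˢ Ioo 0 1, v p * K p.1 p.1 p.2| ≤ 0 := by
    refine le_of_forall_pos_le_add fun ε hε => ?_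
    set V := ∫ p in Ioc a b ×ˢ Ioo 0 1, |v p|
    refine (claim (ε / (V + 1)) (by positivity)).trans ?_
    rw [zero_add, div_mul_eq_mul_div, div_le_iff₀ (by positivity)]
    nlinarith
  have := abs_nonpos_iff.1 this
  linarith

/-! ### The equation holds almost everywhere. -/

/-- This periodic extension is smooth across the integers because near any point it is the sum of
two translates of `η`, at most one of which is nonzero at a time. -/
theorem contDiff_comp_fract {η : ℝ × ℝ → ℝ} (hη : ContDiff ℝ ∞ η)
    (h0 : ∀ p : ℝ × ℝ, p.2 ∉ Ioo (0 : ℝ) 1 → η p = 0) :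
    ContDiff ℝ ∞ fun p : ℝ × ℝ => η (p.1, Int.fract p.2) := by
  rw [contDiff_iff_contDiffAt]
  intro p₀
  set n : ℤ := ⌊p₀.2⌋
  have hsm : ContDiff ℝ ∞ fun p : ℝ × ℝ => η (p.1, p.2 - n) + η (p.1, p.2 - n + 1) :=
    (hη.comp (by fun_prop)).add (hη.comp (by fun_prop))
  refine hsm.contDiffAt.congr_of_eventuallyEq ?_
  have hopen : {p : ℝ × ℝ | (n : ℝ) - 1 < p.2 ∧ p.2 < n + 1} ∈ 𝓝 p₀ := by
    refine IsOpen.mem_nhds ((isOpen_lt continuous_const continuous_snd).inter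
      (isOpen_lt continuous_snd continuous_const)) ⟨?_, Int.lt_floor_add_one _⟩
    have : (n : ℝ) ≤ p₀.2 := Int.floor_le _
    linarith
  filter_upwards [hopen] with p hp
  rcases lt_or_ge p.2 n with h | h
  · have hf : Int.fract p.2 = p.2 - n + 1 := by
      rw [Int.fract_eq_iff]
      exact ⟨by linarith [hp.1], by linarith, n - 1, by push_cast; ring⟩
    rw [hf, h0 (p.1, p.2 - n) fun hc => by linarith [hc.1], zero_add]
  · have hf : Int.fract p.2 = p.2 - n := by
      rw [Int.fract_eq_iff]
      exact ⟨by linarith, by linarith [hp.2], n, by ring⟩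
    rw [hf, h0 (p.1, p.2 - n + 1) fun hc => by linarith [hc.2], add_zero]

/-- An integrable function which is orthogonal to all smooth space-periodic functions vanishes. -/
theorem ae_eq_zero_of_forall_periodic_test {T : ℝ} {m : ℝ × ℝ → ℝ}
    (hm : IntegrableOn m (Ioo 0 T ×ˢ Ioo 0 1))
    (h : ∀ φ : ℝ × ℝ → ℝ, ContDiff ℝ ∞ φ → (∀ t h, φ (t, h + 1) = φ (t, h)) →
      ∫ p in Ioo 0 T ×ˢ Ioo 0 1, φ p * m p = 0) :
    ∀ᵐ p : ℝ × ℝ, p ∈ Ioo 0 T ×ˢ Ioo (0 : ℝ) 1 → m p = 0 := by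
  refine (isOpen_Ioo.prod isOpen_Ioo : IsOpen (Ioo 0 T ×ˢ Ioo (0 : ℝ) 1)).ae_eq_zero_of_integral_contDiff_smul_eq_zero
    hm.locallyIntegrableOn fun η hη _ hs => ?_
  have h0 : ∀ p : ℝ × ℝ, p ∉ Ioo 0 T ×ˢ Ioo (0 : ℝ) 1 → η p = 0 := fun p hp =>
    image_eq_zero_of_notMem_tsupport fun h => hp (hs h)
  have := h _ (contDiff_comp_fract hη fun p hp => h0 p fun hc => hp hc.2) fun t h => by simp
  rw [← setIntegral_eq_integral_of_forall_compl_eq_zero (s := Ioo 0 T ×ˢ Ioo (0 : ℝ) 1)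
    fun p hp => by rw [h0 p hp, zero_smul]]
  refine Eq.trans ?_ this
  refine setIntegral_congr_fun (s := Ioo 0 T ×ˢ Ioo (0 : ℝ) 1)
    (measurableSet_Ioo.prod measurableSet_Ioo) fun p hp => ?_
  simp only [smul_eq_mul]
  rw [Int.fract_eq_self.2 ⟨hp.2.1.le, hp.2.2⟩]

/-- The indicator carries information: the time derivative vanishes almost everywhere off `P`, so
the dissipation, which is integrated over `P` only, controls it on the whole strip. -/
theorem ae_eq_neg_of_weak_equation {T : ℝ} {P : Set (ℝ × ℝ)} (hP : MeasurableSet P)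
    (hPS : P ⊆ Ioo 0 T ×ˢ Ioo 0 1) {v r : ℝ × ℝ → ℝ} (hv : IntegrableOn v (Ioo 0 T ×ˢ Ioo 0 1))
    (hr : IntegrableOn r P)
    (h : ∀ φ : ℝ × ℝ → ℝ, ContDiffOn ℝ ∞ φ (Icc 0 T ×ˢ univ) →
      (∀ t ∈ Icc 0 T, ∀ h, φ (t, h + 1) = φ (t, h)) →
      (∫ p in Ioo 0 T ×ˢ Ioo 0 1, φ p * v p) + (∫ p in P, φ p * r p) = 0) :
    ∀ᵐ p : ℝ × ℝ, p ∈ Ioo 0 T ×ˢ Ioo (0 : ℝ) 1 → v p = -P.indicator r p := by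
  have hri : IntegrableOn (P.indicator r) (Ioo 0 T ×ˢ Ioo 0 1) := by
    rw [IntegrableOn, integrable_indicator_iff hP, IntegrableOn, Measure.restrict_restrict hP,
      inter_eq_left.2 hPS]
    exact hr
  have hbdd : ∀ φ : ℝ × ℝ → ℝ, Continuous φ → ∃ M, ∀ᵐ p ∂(volume.restrict (Ioo 0 T ×ˢ Ioo 0 1)),
      ‖φ p‖ ≤ M := by
    intro φ hφ
    obtain ⟨M, hM⟩ := ((isCompact_Icc (a := (0 : ℝ)) (b := T)).prod
      (isCompact_Icc (a := (0 : ℝ)) (b := 1))).exists_bound_of_continuousOn hφ.continuousOn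
    refine ⟨M, ?_⟩
    filter_upwards [ae_restrict_mem (measurableSet_Ioo.prod measurableSet_Ioo)] with p hp
    exact hM p ⟨Ioo_subset_Icc_self hp.1, Ioo_subset_Icc_self hp.2⟩
  have := ae_eq_zero_of_forall_periodic_test (hv.add hri) fun φ hφ hper => by
    obtain ⟨M, hM⟩ := hbdd φ hφ.continuous
    have i1 := hv.bdd_mul (c := M) hφ.continuous.aestronglyMeasurable hM
    have i2 := hri.bdd_mul (c := M) hφ.continuous.aestronglyMeasurable hM
    have e := h φ hφ.contDiffOn fun t _ => hper t
    have e2 : ∫ p in P, φ p * r p = ∫ p in Ioo 0 T ×ˢ Ioo 0 1, φ p * P.indicator r p := by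
      have : ∀ p, φ p * P.indicator r p = P.indicator (fun p => φ p * r p) p := fun p => by
        by_cases hp : p ∈ P <;> simp [hp]
      simp_rw [this]
      rw [setIntegral_indicator hP, inter_eq_right.2 hPS]
    simp only [Pi.add_apply, mul_add]
    rw [integral_add i1 i2, ← e2, e]
  filter_upwards [this] with p hp hpS
  have := hp hpS
  simp only [Pi.add_apply] at this
  linarith

/-! ### The fourth space derivative is periodic and has mean zero over a period. -/

theorem measurePreserving_shift :
    MeasurePreserving (fun p : ℝ × ℝ => p + ((0 : ℝ), (1 : ℝ))) volume volume :=
  measurePreserving_add_right volume _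

theorem integrable_mul_of_tsupport_subset {Ω : Set (ℝ × ℝ)} {y φ : ℝ × ℝ → ℝ}
    (hy : LocallyIntegrableOn y Ω) (hφ : Continuous φ) (hc : HasCompactSupport φ)
    (hs : tsupport φ ⊆ Ω) : Integrable fun p => y p * φ p := by
  have h0 : ∀ p, p ∉ tsupport φ → φ p = 0 := fun p => image_eq_zero_of_notMem_tsupport
  have hy' := hy.integrableOn_compact_subset hs hc.isCompact
  obtain ⟨M, hM⟩ := hc.exists_bound_of_continuous hφ
  have := hy'.mul_bdd (c := M) hφ.aestronglyMeasurable (Eventually.of_forall hM)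
  refine (integrableOn_iff_integrable_of_support_subset fun p hp => ?_).1 this
  by_contra hcon
  exact hp (by simp only [h0 p hcon, mul_zero])

theorem iteratedDeriv_slice_eq_zero (k : ℕ) {φ : ℝ × ℝ → ℝ} {p : ℝ × ℝ} (hp : p ∉ tsupport φ) :
    iteratedDeriv k (fun s => φ (p.1, s)) p.2 = 0 := by
  have h0 : (fun s => φ (p.1, s)) =ᶠ[𝓝 p.2] fun _ => 0 := by
    have := (isClosed_tsupport φ).isOpen_compl.mem_nhds hp
    have hc : Tendsto (fun s : ℝ => (p.1, s)) (𝓝 p.2) (𝓝 p) :=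
      (by fun_prop : Continuous fun s : ℝ => (p.1, s)).tendsto p.2
    filter_upwards [hc.eventually this] with s hs
    exact image_eq_zero_of_notMem_tsupport hs
  rw [h0.iteratedDeriv_eq]
  cases k <;> simp

/-- Testing with `φ` and with its translate gives the same left-hand side, since `f` is periodic on
`Ω`. Off `Ω` nothing is known of `f`, but there the derivatives of `φ` vanish. -/
theorem HasWeakSpaceDerivOn.integral_shift_mul {k : ℕ} {Ω : Set (ℝ × ℝ)}
    (hshift : ∀ p : ℝ × ℝ, p + (0, 1) ∈ Ω ↔ p ∈ Ω) {f z : ℝ × ℝ → ℝ}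
    (h : HasWeakSpaceDerivOn k Ω f z) (hf : ∀ p ∈ Ω, f (p + (0, 1)) = f p) {φ : ℝ × ℝ → ℝ}
    (hφ : ContDiff ℝ ∞ φ) (hc : HasCompactSupport φ) (hs : tsupport φ ⊆ Ω) :
    ∫ p : ℝ × ℝ, z (p + (0, 1)) * φ p = ∫ p, z p * φ p := by
  set φ' : ℝ × ℝ → ℝ := fun p => φ (p - (0, 1)) with hφ'
  have hφs : ContDiff ℝ ∞ φ' := hφ.comp (contDiff_id.sub contDiff_const)
  have hφc : HasCompactSupport φ' := hc.comp_homeomorph (Homeomorph.subRight ((0 : ℝ), (1 : ℝ)))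
  have hs' : tsupport φ' ⊆ Ω := by
    have e : tsupport φ' = (Homeomorph.subRight ((0 : ℝ), (1 : ℝ))) ⁻¹' tsupport φ :=
      tsupport_comp_eq_preimage φ (Homeomorph.subRight ((0 : ℝ), (1 : ℝ)))
    intro p hp
    rw [e] at hp
    have := (hshift (p - (0, 1))).2 (hs hp)
    simpa using this
  have e1 := h.2.2 φ hφ hc hs
  have e2 := h.2.2 φ' hφs hφc hs'
  rw [← integral_add_right_eq_self (fun p => z p * φ' p) ((0 : ℝ), (1 : ℝ)),
    ← integral_add_right_eq_self (fun p => f p * iteratedDeriv k (fun s => φ' (p.1, s)) p.2)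
      ((0 : ℝ), (1 : ℝ))] at e2
  have e3 : ∀ p : ℝ × ℝ, f (p + (0, 1)) * iteratedDeriv k (fun s => φ' ((p + (0, 1)).1, s))
      (p + (0, 1)).2 = f p * iteratedDeriv k (fun s => φ (p.1, s)) p.2 := by
    rintro ⟨t, x⟩
    have : iteratedDeriv k (fun s => φ' (((t, x) + ((0 : ℝ), (1 : ℝ))).1, s))
        ((t, x) + ((0 : ℝ), (1 : ℝ))).2 = iteratedDeriv k (fun s => φ (t, s)) x := by
      have := congrFun (iteratedDeriv_comp_sub_const k (fun s => φ (t, s)) 1) (x + 1)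
      simp only [add_sub_cancel_right] at this
      rw [← this]
      simp only [hφ', Prod.mk_add_mk, add_zero, Prod.mk_sub_mk, sub_zero]
    rw [this]
    by_cases hp : (t, x) ∈ Ω
    · rw [hf _ hp]
    · rw [iteratedDeriv_slice_eq_zero k (p := (t, x)) fun h => hp (hs h), mul_zero, mul_zero]
  simp only [e3] at e2
  simp only [hφ', add_sub_cancel_right] at e2
  exact mul_left_cancel₀ (pow_ne_zero k (by norm_num : (-1 : ℝ) ≠ 0)) (e2.symm.trans e1)

theorem HasWeakSpaceDerivOn.ae_periodic {k : ℕ} {Ω : Set (ℝ × ℝ)} (hΩ : IsOpen Ω)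
    (hshift : ∀ p : ℝ × ℝ, p + (0, 1) ∈ Ω ↔ p ∈ Ω) {f z : ℝ × ℝ → ℝ}
    (h : HasWeakSpaceDerivOn k Ω f z) (hf : ∀ p ∈ Ω, f (p + (0, 1)) = f p) :
    ∀ᵐ p : ℝ × ℝ, p ∈ Ω → z (p + (0, 1)) - z p = 0 := by
  have hemb : MeasurableEmbedding fun p : ℝ × ℝ => p + ((0 : ℝ), (1 : ℝ)) :=
    measurableEmbedding_addRight _
  have hz := (locallyIntegrableOn_iff hΩ.isLocallyClosed).1 h.2.1
  have hz' : LocallyIntegrableOn (fun p => z (p + (0, 1))) Ω := by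
    refine (locallyIntegrableOn_iff hΩ.isLocallyClosed).2 fun K hK hKc => ?_
    have := measurePreserving_shift.integrableOn_comp_preimage hemb (f := z)
      (s := (fun p => p + ((0 : ℝ), (1 : ℝ))) '' K)
    rw [preimage_image_eq _ (add_left_injective _)] at this
    refine this.2 (hz _ ?_ (hKc.image (continuous_add_const _)))
    rintro _ ⟨p, hp, rfl⟩
    exact (hshift p).2 (hK hp)
  refine hΩ.ae_eq_zero_of_integral_contDiff_smul_eq_zero (hz'.sub h.2.1) fun φ hφ hc hs => ?_
  simp only [smul_eq_mul, mul_comm (φ _), sub_mul]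
  rw [integral_sub (integrable_mul_of_tsupport_subset hz' hφ.continuous hc hs)
    (integrable_mul_of_tsupport_subset h.2.1 hφ.continuous hc hs),
    h.integral_shift_mul hshift hf hφ hc hs, sub_self]

/-- The integer translates of this cutoff form a partition of unity, which unfolds an integral over
a period into one over the line with a compactly supported test function. -/
theorem smoothStep_add_one {x : ℝ} (hx : x ∈ Ioc (0 : ℝ) 1) :
    smoothStep 0 1 0 x + smoothStep 0 1 0 (x + 1) = 1 := by
  simp only [smoothStep, Nat.cast_zero, zero_add, mul_one, sub_zero, add_sub_cancel_right]
  rw [Real.smoothTransition.one_of_one_le (x := x + 1) (by linarith [hx.1]),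
    Real.smoothTransition.zero_of_nonpos (x := x - 1) (by linarith [hx.2])]
  ring

theorem iteratedDeriv_smoothStep (x : ℝ) : iteratedDeriv 4 (smoothStep 0 1 0) x =
    iteratedDeriv 4 Real.smoothTransition x - iteratedDeriv 4 Real.smoothTransition (x - 1) := by
  have : smoothStep 0 1 0 =
      fun x => Real.smoothTransition x - Real.smoothTransition (x - 1) := by
    funext x
    simp [smoothStep]
  rw [this, iteratedDeriv_fun_sub, iteratedDeriv_comp_sub_const]
  · exact Real.smoothTransition.contDiff.contDiffAt
  · exact (Real.smoothTransition.contDiff.comp (by fun_prop)).contDiffAt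

/-- The transition itself is $1$ near $+\infty$; its derivatives are compactly supported, so the two
terms of the fourth derivative of the cutoff can be integrated separately against a periodic
function. -/
theorem hasCompactSupport_iteratedDeriv_smoothTransition :
    HasCompactSupport (iteratedDeriv 4 Real.smoothTransition) := by
  rw [iteratedDeriv_succ', iteratedDeriv_eq_iterate]
  exact hasCompactSupport_deriv_smoothTransition.deriv.deriv.deriv

/-- Test with $\chi(t)\psi(x)$, where the translates of $\psi$ sum to $1$. On the side of `z` this
produces the integral over one period; on the side of `f`, $\psi''''$ is a difference of two
translates by a period, whose pairings with a periodic function cancel. -/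
theorem HasWeakSpaceDerivOn.integral_eq_zero {a b : ℝ} (hab : a ≤ b) {Ω : Set (ℝ × ℝ)}
    (hsub : Ioo a b ×ˢ univ ⊆ Ω) {f z : ℝ × ℝ → ℝ} (h : HasWeakSpaceDerivOn 4 Ω f z)
    {w : ℝ → ℝ → ℝ} (hw : Continuous fun p : ℝ × ℝ => w p.1 p.2)
    (hper : ∀ t x, w t (x + 1) = w t x) (hfw : ∀ t ∈ Ioo a b, ∀ x, f (t, x) = w t x)
    (hz : IntegrableOn z (Ioo a b ×ˢ Ioc 0 1)) :
    ∫ p in Ioo a b ×ˢ Ioc 0 1, z p = 0 := by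
  have hΩ' : IsOpen (Ioo a b ×ˢ (univ : Set ℝ)) := isOpen_Ioo.prod isOpen_univ
  have hzp : ∀ᵐ p : ℝ × ℝ, p ∈ Ioo a b ×ˢ univ → z (p + (0, 1)) = z p := by
    simp only [← sub_eq_zero (b := z _)]
    refine HasWeakSpaceDerivOn.ae_periodic (k := 4) (f := f) hΩ' (fun p => by simp)
      ⟨h.1.mono_set hsub, h.2.1.mono_set hsub, fun φ hφ hc hs => h.2.2 φ hφ hc (hs.trans hsub)⟩
      fun p hp => ?_
    change f (p.1 + 0, p.2 + 1) = f (p.1, p.2)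
    rw [add_zero, hfw _ hp.1, hfw _ hp.1, hper]
  have hemb : MeasurableEmbedding fun p : ℝ × ℝ => p + ((0 : ℝ), (1 : ℝ)) :=
    measurableEmbedding_addRight _
  have hm : ∀ c d : ℝ, MeasurableSet (Ioo a b ×ˢ Ioc c d) := fun c d =>
    measurableSet_Ioo.prod measurableSet_Ioc
  have hpre : (fun p : ℝ × ℝ => p + ((0 : ℝ), (1 : ℝ))) ⁻¹' (Ioo a b ×ˢ Ioc 1 2) =
      Ioo a b ×ˢ Ioc 0 1 := by
    ext p
    simp only [mem_preimage, mem_prod, Prod.fst_add, add_zero, Prod.snd_add, mem_Ioc]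
    refine and_congr_right fun _ => ⟨fun h => ⟨by linarith [h.1], by linarith [h.2]⟩,
      fun h => ⟨by linarith [h.1], by linarith [h.2]⟩⟩
  have hz2 : IntegrableOn z (Ioo a b ×ˢ Ioc 1 2) := by
    rw [← measurePreserving_shift.integrableOn_comp_preimage hemb, hpre]
    refine hz.congr ?_
    filter_upwards [ae_restrict_of_ae hzp, ae_restrict_mem (hm 0 1)] with p hp hpm
    exact (hp ⟨hpm.1, mem_univ _⟩).symm
  set ζ : ℝ → ℝ := fun t => ∫ x in Ioc (0 : ℝ) 1, z (t, x)
  have hz' : Integrable z ((volume.restrict (Ioo a b)).prod (volume.restrict (Ioc 0 1))) := by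
    rw [Measure.prod_restrict, ← Measure.volume_eq_prod]
    exact hz
  have hζ : IntegrableOn ζ (Ioo a b) := hz'.integral_prod_left
  -- The space integral `ζ` of `z` is the weak time derivative of the zero function, so its integral
  -- over $[a,b]$ vanishes.
  have main : ∀ χ : ℝ → ℝ, ContDiff ℝ ∞ χ → HasCompactSupport χ → tsupport χ ⊆ Ioo a b →
      ∫ t, (0 : ℝ) * deriv χ t = -∫ t, ζ t * χ t := by
    intro χ hχ hχc hχs
    set ψ : ℝ → ℝ := smoothStep 0 1 0
    have hψ : ContDiff ℝ ∞ ψ := contDiff_smoothStep 0 1 0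
    have hψc : HasCompactSupport ψ := hasCompactSupport_smoothStep zero_le_one 0
    have hχ0 : ∀ τ, τ ∉ Ioo a b → χ τ = 0 := fun x hx =>
      image_eq_zero_of_notMem_tsupport fun hx' => hx (hχs hx')
    have hψ0 : ∀ x, x ∉ Ioc (0 : ℝ) 2 → ψ x = 0 := by
      intro x hx
      by_cases hx0 : x = 0
      · rw [hx0]
        simp only [ψ, smoothStep]
        rw [Real.smoothTransition.zero_of_nonpos (by norm_num),
          Real.smoothTransition.zero_of_nonpos (by norm_num), sub_self]
      · refine smoothStep_eq_zero zero_le_one fun hx' => hx ⟨?_, ?_⟩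
        · exact lt_of_le_of_ne hx'.1 (Ne.symm hx0)
        · have := hx'.2
          norm_num at this
          linarith
    have hsupp : tsupport (fun p : ℝ × ℝ => χ p.1 * ψ p.2) ⊆ tsupport χ ×ˢ tsupport ψ := by
      refine closure_minimal (fun p hp => ?_)
        ((isClosed_tsupport χ).prod (isClosed_tsupport ψ))
      exact ⟨subset_tsupport χ (left_ne_zero_of_mul hp),
        subset_tsupport ψ (right_ne_zero_of_mul hp)⟩
    have key := h.2.2 (fun p => χ p.1 * ψ p.2)
      ((hχ.comp contDiff_fst).mul (hψ.comp contDiff_snd))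
      ((hχc.isCompact.prod hψc.isCompact).of_isClosed_subset (isClosed_tsupport _) hsupp)
      (hsupp.trans ((prod_mono hχs (subset_univ _)).trans hsub))
    set S4 := iteratedDeriv 4 Real.smoothTransition with hS4
    have hS4c : Continuous S4 :=
      (Real.smoothTransition.contDiff (n := 4)).continuous_iteratedDeriv 4 (by norm_num)
    set H : ℝ × ℝ → ℝ := fun p => w p.1 p.2 * (χ p.1 * S4 p.2)
    have hH : Integrable H := by
      refine Continuous.integrable_of_hasCompactSupport (hw.mul
        ((hχ.continuous.comp continuous_fst).mul (hS4c.comp continuous_snd))) ?_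
      refine HasCompactSupport.intro (hχc.isCompact.prod
        hasCompactSupport_iteratedDeriv_smoothTransition.isCompact) fun p hp => ?_
      by_cases h1 : p.1 ∈ tsupport χ
      · have h2 : p.2 ∉ tsupport S4 := fun h2 => hp ⟨h1, h2⟩
        simp only [H]
        rw [image_eq_zero_of_notMem_tsupport h2, mul_zero, mul_zero]
      · simp only [H]
        rw [image_eq_zero_of_notMem_tsupport h1, zero_mul, mul_zero]
    have hl : ∀ p : ℝ × ℝ, f p * iteratedDeriv 4 (fun s => χ p.1 * ψ s) p.2 =
        H p - H (p - (0, 1)) := by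
      intro p
      rw [iteratedDeriv_const_mul_field, iteratedDeriv_smoothStep]
      have hw' : w p.1 (p.2 - 1) = w p.1 p.2 := by
        have := hper p.1 (p.2 - 1)
        rw [sub_add_cancel] at this
        exact this.symm
      simp only [H, Prod.fst_sub, Prod.snd_sub, sub_zero, hw']
      by_cases h1 : p.1 ∈ Ioo a b
      · rw [← hfw p.1 h1]
        ring
      · rw [hχ0 _ h1]
        ring
    simp only [hl] at key
    rw [integral_sub hH (hH.comp_sub_right _), integral_sub_right_eq_self, sub_self] at key
    have hzero : ∫ p : ℝ × ℝ, z p * (χ p.1 * ψ p.2) = 0 := by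
      have : (-1 : ℝ) ^ 4 = 1 := by norm_num
      rw [this, one_mul] at key
      exact key.symm
    have hbd : ∀ θ : ℝ → ℝ, Continuous θ → HasCompactSupport θ → ∀ c d : ℝ,
        IntegrableOn z (Ioo a b ×ˢ Ioc c d) →
        IntegrableOn (fun p : ℝ × ℝ => z p * (χ p.1 * θ p.2)) (Ioo a b ×ˢ Ioc c d) := by
      intro θ hθ hθc c d hzi
      obtain ⟨M, hM⟩ := hχc.exists_bound_of_continuous hχ.continuous
      obtain ⟨M', hM'⟩ := hθc.exists_bound_of_continuous hθ
      refine hzi.mul_bdd (c := M * M') ((hχ.continuous.comp continuous_fst).mul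
        (hθ.comp continuous_snd)).aestronglyMeasurable (Eventually.of_forall fun p => ?_)
      rw [norm_mul]
      exact mul_le_mul (hM _) (hM' _) (norm_nonneg _) ((norm_nonneg _).trans (hM 0))
    have hψ1 : Continuous fun x => ψ (x + 1) := hψ.continuous.comp (continuous_add_const 1)
    have hψ1c : HasCompactSupport fun x => ψ (x + 1) :=
      hψc.comp_homeomorph (Homeomorph.addRight (1 : ℝ))
    have hsplit : ∫ p : ℝ × ℝ, z p * (χ p.1 * ψ p.2) =
        ∫ p in Ioo a b ×ˢ Ioc 0 1, z p * χ p.1 := by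
      have e1 : Ioo a b ×ˢ Ioc (0 : ℝ) 2 = Ioo a b ×ˢ Ioc 0 1 ∪ Ioo a b ×ˢ Ioc 1 2 := by
        rw [← prod_union, Ioc_union_Ioc_eq_Ioc zero_le_one one_le_two]
      have hdisj : Disjoint (Ioo a b ×ˢ Ioc (0 : ℝ) 1) (Ioo a b ×ˢ Ioc (1 : ℝ) 2) :=
        Disjoint.set_prod_right (Ioc_disjoint_Ioc_of_le le_rfl) _ _
      rw [← setIntegral_eq_integral_of_forall_compl_eq_zero (s := Ioo a b ×ˢ Ioc (0 : ℝ) 2)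
        fun p hp => by
          by_cases h1 : p.1 ∈ Ioo a b
          · rw [hψ0 p.2 fun h2 => hp ⟨h1, h2⟩, mul_zero, mul_zero]
          · rw [hχ0 p.1 h1, zero_mul, mul_zero],
        e1, setIntegral_union hdisj (hm 1 2) (hbd ψ hψ.continuous hψc 0 1 hz)
          (hbd ψ hψ.continuous hψc 1 2 hz2),
        ← measurePreserving_shift.setIntegral_preimage_emb hemb
          (fun p => z p * (χ p.1 * ψ p.2)) (Ioo a b ×ˢ Ioc 1 2), hpre]
      have e2 : ∫ p in Ioo a b ×ˢ Ioc (0 : ℝ) 1, z (p + (0, 1)) * (χ (p + (0, 1)).1 *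
          ψ (p + (0, 1)).2) = ∫ p in Ioo a b ×ˢ Ioc (0 : ℝ) 1, z p * (χ p.1 * ψ (p.2 + 1)) := by
        refine setIntegral_congr_ae (hm 0 1) ?_
        filter_upwards [hzp] with p hp hpm
        rw [hp ⟨hpm.1, mem_univ _⟩]
        simp
      rw [e2, ← integral_add (hbd ψ hψ.continuous hψc 0 1 hz) (hbd _ hψ1 hψ1c 0 1 hz)]
      refine setIntegral_congr_fun (hm 0 1) fun p hp => ?_
      rw [← mul_add, ← mul_add, smoothStep_add_one hp.2, mul_one]
    have hfub : ∫ p in Ioo a b ×ˢ Ioc 0 1, z p * χ p.1 = ∫ t, ζ t * χ t := by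
      obtain ⟨M, hM⟩ := hχc.exists_bound_of_continuous hχ.continuous
      have hi := hz'.mul_bdd (c := M) (g := fun p : ℝ × ℝ => χ p.1)
        (hχ.continuous.comp continuous_fst).aestronglyMeasurable
        (Eventually.of_forall fun p => hM p.1)
      rw [← setIntegral_eq_integral_of_forall_compl_eq_zero (s := Ioo a b)
        fun t ht => by rw [hχ0 t ht, mul_zero], Measure.volume_eq_prod, ← Measure.prod_restrict,
        integral_prod _ hi]
      refine integral_congr_ae (Eventually.of_forall fun t => ?_)
      simp only [ζ]
      rw [← integral_mul_const]
    rw [← hfub, ← hsplit, hzero]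
    simp
  have := sub_eq_integral_of_forall_test (f := fun _ => 0) continuous_const hζ main le_rfl hab
    le_rfl
  rw [Measure.volume_eq_prod, ← Measure.prod_restrict, integral_prod _ hz',
    restrict_Ioo_eq_restrict_Ioc, ← intervalIntegral.integral_of_le hab, ← this, sub_self]

/-! ### From weak solutions to the bounds used in the estimates. -/

/-- The properties of a weak solution `U`, extended to all times, with time derivative `v` and
initial data of norm `N`, which enter the a priori estimates. -/
structure EnergySolution (T N : ℝ) (U : ℝ → ℝ → ℝ) (v : ℝ × ℝ → ℝ) : Prop where
  continuous : Continuous fun p : ℝ × ℝ => U p.1 p.2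
  nonneg : ∀ t x, 0 ≤ U t x
  periodic : ∀ t, Function.Periodic (U t) 1
  integrable : IntegrableOn v (Ioc 0 T ×ˢ Ioo 0 1)
  increment : ∀ s t, 0 ≤ s → s ≤ t → t ≤ T → ∀ ψ : ℝ → ℝ, Continuous ψ →
    ∫ x in Ioo (0 : ℝ) 1, (U t x - U s x) * ψ x = ∫ p in Ioc s t ×ˢ Ioo 0 1, v p * ψ p.2
  velocity : ∫⁻ p in Ioc 0 T ×ˢ Ioo 0 1, ENNReal.ofReal (v p ^ 2) ≤ ENNReal.ofReal (N ^ 2)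
  energy : ∫⁻ t in Ioc 0 T, derivL2Sq 2 (fun x => U t x ^ 3) ≤ ENNReal.ofReal (1 + N ^ 2)
  initial : derivL2Sq 0 (fun x => U 0 x ^ 3) + derivL2Sq 1 (fun x => U 0 x ^ 3) ≤
    ENNReal.ofReal (N ^ 2)
  reciprocal : ∀ a b, 0 ≤ a → a ≤ b → b ≤ T → (∀ t ∈ Icc a b, ∀ x, 0 < U t x) →
    ∫ p in Ioc a b ×ˢ Ioo 0 1, v p * (U p.1 p.2 ^ 2)⁻¹ = 0

/-- The pointwise bound $y^2\le1+y^6$ lets $F(u_0)$ be controlled by the $L^2$ norm of $u_0^3$. -/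
theorem F_le {f : ℝ → ℝ} : 2 * F f ≤ 1 + ∫⁻ x in Ioo (0 : ℝ) 1, ENNReal.ofReal ((f x ^ 3) ^ 2) := by
  rw [F, ENNReal.mul_div_cancel two_ne_zero ENNReal.ofNat_ne_top]
  calc _ ≤ ∫⁻ x in Ioo (0 : ℝ) 1, (1 + ENNReal.ofReal ((f x ^ 3) ^ 2)) := by
        refine lintegral_mono fun x => ?_
        rw [← ENNReal.ofReal_one, ← ENNReal.ofReal_add zero_le_one (by positivity)]
        refine ENNReal.ofReal_le_ofReal ?_
        have h : 0 ≤ f x ^ 2 := sq_nonneg _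
        rcases le_total (f x ^ 2) 1 with h1 | h1
        · nlinarith [sq_nonneg (f x ^ 3)]
        · nlinarith [mul_le_mul h1 h1 zero_le_one h, sq_nonneg (f x ^ 2 - 1)]
    _ = _ := by
        rw [lintegral_add_left measurable_const]
        simp

theorem IsWeakSolution.exists_energySolution {T : ℝ} (hT : 0 < T) {u₀ : ℝ → ℝ}
    (h₀ : MemHper 2 fun h => u₀ h ^ 3) {u : ℝ → ℝ → ℝ} (hu : IsWeakSolution T u₀ u) :
    ∃ (U : ℝ → ℝ → ℝ) (v : ℝ × ℝ → ℝ),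
      EnergySolution T (sobolevNorm 2 fun h => u₀ h ^ 3).toReal U v ∧
        ∀ t ∈ Icc 0 T, U t = u t := by
  obtain ⟨hnn, hcont, hinit, -, hmem, htend, v, z, hv, hvL, hz, hzL, heq, hE, hF⟩ := hu
  set N := (sobolevNorm 2 fun h => u₀ h ^ 3).toReal
  set c : ℝ → ℝ := fun t => projIcc 0 T hT.le t with hcdef
  have hcI : ∀ t, c t ∈ Icc 0 T := fun t => (projIcc 0 T hT.le t).2
  have hcid : ∀ t ∈ Icc 0 T, c t = t := fun t ht => by
    simp only [c, projIcc_of_mem hT.le ht]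
  set U : ℝ → ℝ → ℝ := fun t => u (c t) with hU
  have hUu : ∀ t ∈ Icc 0 T, U t = u t := fun t ht => by simp only [U, hcid t ht]
  have hUu' : ∀ t ∈ Icc 0 T, ∀ x, u t x = U t x := fun t ht x => by rw [hUu t ht]
  have hUnn : ∀ t x, 0 ≤ U t x := fun t x => hnn _ (hcI t) x
  have hwper : ∀ t ∈ Icc 0 T, Function.Periodic (fun x => u t x ^ 3) 1 := fun t ht =>
    periodic_of_ae ((hcont t ht).pow 3) (hmem t ht).1
  have hper : ∀ t, Function.Periodic (U t) 1 := fun t x =>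
    (pow_left_inj₀ (hUnn t _) (hUnn t x) three_ne_zero).1 (hwper _ (hcI t) x)
  have hUc : Continuous fun p : ℝ × ℝ => U p.1 p.2 := by
    have hW := continuous_uncurry_of_tendsto_sobolevNorm hT.le
      (w := fun t x => u t x ^ 3) (fun t ht => (hcont t ht).pow 3) hwper htend
    -- The regularity in time is known for the cube; continuity of the cube root passes it to `U`.
    have := hW.rpow_const (p := ((3 : ℕ) : ℝ)⁻¹) fun _ => Or.inr (by positivity)
    refine this.congr fun p => ?_
    exact Real.pow_rpow_inv_natCast (hUnn p.1 p.2) three_ne_zero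
  have hS : MeasurableSet (Ioo 0 T ×ˢ Ioo (0 : ℝ) 1) := measurableSet_Ioo.prod measurableSet_Ioo
  have hSfin : volume (Ioo 0 T ×ˢ Ioo (0 : ℝ) 1) ≠ ⊤ := by
    rw [Measure.volume_eq_prod, Measure.prod_prod]
    simp
  have hPeq : PT T u = Ioo 0 T ×ˢ Ioo 0 1 ∩ {p | U p.1 p.2 ≠ 0} := by
    ext p
    refine and_congr_right fun hp => ?_
    simp only [mem_ofPred_eq, hUu' p.1 (Ioo_subset_Icc_self hp.1)]
  have hPm : MeasurableSet (PT T u) := by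
    rw [hPeq]
    exact hS.inter (isOpen_ne_fun hUc continuous_const).measurableSet
  have hPS : PT T u ⊆ Ioo 0 T ×ˢ Ioo 0 1 := sdiff_subset
  have hvS : IntegrableOn v (Ioo 0 T ×ˢ Ioo 0 1) := by
    have : IsFiniteMeasure ((volume : Measure (ℝ × ℝ)).restrict (Ioo 0 T ×ˢ Ioo 0 1)) :=
      ⟨by rw [Measure.restrict_apply_univ]; exact hSfin.lt_top⟩
    exact hvL.integrable one_le_two
  have hrP : IntegrableOn (fun p => u p.1 p.2 ^ 2 * z p) (PT T u) := by
    have : IsFiniteMeasure ((volume : Measure (ℝ × ℝ)).restrict (PT T u)) :=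
      ⟨by
        rw [Measure.restrict_apply_univ]
        exact (measure_mono hPS).trans_lt hSfin.lt_top⟩
    exact hzL.integrable one_le_two
  have hvz := ae_eq_neg_of_weak_equation hPm hPS hvS hrP heq
  have hvI : IntegrableOn v (Ioc 0 T ×ˢ Ioo 0 1) := by
    rw [IntegrableOn, restrict_Ioc_prod_Ioo']
    exact hvS
  have h0I : (0 : ℝ) ∈ Icc 0 T := ⟨le_rfl, hT.le⟩
  have hw0 : (fun x => U 0 x ^ 3) =ᵐ[volume] fun x => u₀ x ^ 3 := by
    filter_upwards [hinit] with x hx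
    rw [hUu 0 h0I, hx]
  have hU0c : Continuous (U 0) := hUc.comp (by fun_prop : Continuous fun x => ((0 : ℝ), x))
  have hNsq : ENNReal.ofReal (N ^ 2) = derivL2Sq 0 (fun x => U 0 x ^ 3) +
      derivL2Sq 1 (fun x => U 0 x ^ 3) + derivL2Sq 2 (fun x => U 0 x ^ 3) := by
    rw [derivL2Sq_congr_ae hw0, derivL2Sq_congr_ae hw0, derivL2Sq_congr_ae hw0,
      ENNReal.ofReal_pow ENNReal.toReal_nonneg, ENNReal.ofReal_toReal h₀.2.ne, sobolevNorm_sq]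
    simp [Finset.sum_range_succ]
  refine ⟨U, v, ⟨hUc, hUnn, hper, hvI, ?_, ?_, ?_, ?_, ?_⟩, hUu⟩
  · intro s t hs hst ht ψ hψ
    exact hv.integral_sub_mul hUc (fun t ht x => hUu' t (Ioo_subset_Icc_self ht) x) hvI hs hst ht hψ
  · rw [restrict_Ioc_prod_Ioo']
    calc _ = ∫⁻ p in Ioo 0 T ×ˢ Ioo 0 1, (PT T u).indicator
          (fun p => ENNReal.ofReal ((u p.1 p.2 ^ 2 * z p) ^ 2)) p := by
          refine setLIntegral_congr_fun_ae hS ?_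
          filter_upwards [hvz] with p hp hpS
          rw [hp hpS]
          by_cases hpP : p ∈ PT T u <;> simp [hpP]
      _ = ∫⁻ p in PT T u, ENNReal.ofReal ((u p.1 p.2 ^ 2 * z p) ^ 2) := by
          rw [setLIntegral_indicator hPm, inter_eq_left.2 hPS]
      -- First dissipation inequality, with the nonnegative final energy dropped.
      _ ≤ E (u 0) := le_trans le_add_self hE
      _ ≤ derivL2Sq 2 (fun x => U 0 x ^ 3) := by
          rw [E, hUu 0 h0I]
          exact ENNReal.div_le_of_le_mul (le_mul_of_one_le_right zero_le (by norm_num))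
      _ ≤ _ := by
          rw [hNsq]
          exact le_add_self
  · rw [← restrict_Ioo_eq_restrict_Ioc]
    calc ∫⁻ t in Ioo 0 T, derivL2Sq 2 (fun x => U t x ^ 3)
        = 6 * ∫⁻ t in Ioo 0 T, E (u t) := by
          rw [← lintegral_const_mul' _ _ ENNReal.ofNat_ne_top]
          refine setLIntegral_congr_fun measurableSet_Ioo fun t ht => ?_
          simp only [E]
          rw [ENNReal.mul_div_cancel (by norm_num) ENNReal.ofNat_ne_top,
            hUu t (Ioo_subset_Icc_self ht)]
      -- Second dissipation inequality; the factor $6$ cancels the one in `E`, and the resulting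
      -- bound does not depend on `T`.
      _ ≤ F (u 0) := le_trans le_add_self hF
      _ ≤ 2 * F (u 0) := le_mul_of_one_le_left zero_le one_le_two
      _ ≤ 1 + derivL2Sq 0 (fun x => U 0 x ^ 3) := by
          rw [derivL2Sq_zero (f := fun x => U 0 x ^ 3) (hU0c.pow 3).locallyIntegrable, hUu 0 h0I]
          exact F_le
      _ ≤ _ := by
          rw [ENNReal.ofReal_add zero_le_one (sq_nonneg _), ENNReal.ofReal_one, hNsq, add_assoc]
          exact add_le_add le_rfl le_self_add
  · rw [hNsq]
    exact le_self_add
  · intro a b ha hab hb hpos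
    have hR : Ioo a b ×ˢ Ioo (0 : ℝ) 1 ⊆ PT T u := by
      rw [hPeq]
      rintro p ⟨hp1, hp2⟩
      exact ⟨⟨⟨ha.trans_lt hp1.1, hp1.2.trans_le hb⟩, hp2⟩,
        (hpos p.1 (Ioo_subset_Icc_self hp1) p.2).ne'⟩
    have hRm : MeasurableSet (Ioo a b ×ˢ Ioo (0 : ℝ) 1) := measurableSet_Ioo.prod measurableSet_Ioo
    have hRI : ∀ p ∈ Ioo a b ×ˢ Ioo (0 : ℝ) 1, p.1 ∈ Icc 0 T := fun p hp =>
      Ioo_subset_Icc_self (hPS (hR hp)).1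
    have hcongr : (volume : Measure (ℝ × ℝ)).restrict (Ioo a b ×ˢ Ioc 0 1) =
        volume.restrict (Ioo a b ×ˢ Ioo 0 1) := by
      rw [Measure.volume_eq_prod, ← Measure.prod_restrict, ← Measure.prod_restrict,
        restrict_Ioo_eq_restrict_Ioc (b := (1 : ℝ))]
    have hUinv : ContinuousOn (fun p : ℝ × ℝ => (U p.1 p.2 ^ 2)⁻¹) (Icc a b ×ˢ Icc 0 1) :=
      (hUc.pow 2).continuousOn.inv₀ fun p hp => (pow_pos (hpos p.1 hp.1 p.2) 2).ne'
    -- `U` is bounded below on the compact rectangle, so `z` inherits integrability from $u^2z$. The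
    -- equation then reads $v/U^2=-z$ there, and `z` has mean zero.
    obtain ⟨M, hM⟩ := (isCompact_Icc.prod isCompact_Icc).exists_bound_of_continuousOn hUinv
    have hzR : IntegrableOn z (Ioo a b ×ˢ Ioo 0 1) := by
      have := (hrP.mono_set hR).mul_bdd (c := M) (g := fun p : ℝ × ℝ => (U p.1 p.2 ^ 2)⁻¹)
        ((hUc.measurable.pow_const 2).inv.aestronglyMeasurable) (by
          filter_upwards [ae_restrict_mem hRm] with p hp
          exact hM p ⟨Ioo_subset_Icc_self hp.1, Ioo_subset_Icc_self hp.2⟩)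
      refine this.congr ?_
      filter_upwards [ae_restrict_mem hRm] with p hp
      have := (hpos p.1 (Ioo_subset_Icc_self hp.1) p.2).ne'
      rw [hUu' p.1 (hRI p hp)]
      field_simp
    have hsub : Ioo a b ×ˢ univ ⊆ positivitySet T u := by
      rintro p ⟨hp, -⟩
      refine ⟨⟨ha.trans_lt hp.1, hp.2.trans_le hb⟩, ?_⟩
      rw [hUu' p.1 ⟨(ha.trans_lt hp.1).le, (hp.2.trans_le hb).le⟩]
      exact (hpos p.1 (Ioo_subset_Icc_self hp) p.2).ne'
    have hzero := hz.integral_eq_zero hab hsub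
      (w := fun t x => U t x ^ 3) (hUc.pow 3) (fun t x => by rw [hper t x])
      (fun t ht x => by
        simp only
        rw [hUu' t ⟨(ha.trans_lt ht.1).le, (ht.2.trans_le hb).le⟩])
      (by rw [IntegrableOn, hcongr]; exact hzR)
    rw [hcongr] at hzero
    rw [restrict_Ioc_prod_Ioo']
    calc _ = ∫ p in Ioo a b ×ˢ Ioo 0 1, -z p := by
          refine setIntegral_congr_ae hRm ?_
          filter_upwards [hvz] with p hp hpR
          have := (hpos p.1 (Ioo_subset_Icc_self hpR.1) p.2).ne'
          rw [hp (hPS (hR hpR)), indicator_of_mem (hR hpR), hUu' p.1 (hRI p hpR)]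
          field_simp
      _ = 0 := by rw [integral_neg, hzero, neg_zero]

/-! ### Periodic summation by parts, Cauchy–Schwarz and a last-crossing argument. -/

theorem setIntegral_Ioo_shift_of_periodic {f : ℝ → ℝ} (hf : Function.Periodic f 1) (k : ℝ) :
    ∫ x in Ioo (0 : ℝ) 1, f (x + k) = ∫ x in Ioo (0 : ℝ) 1, f x := by
  rw [restrict_Ioo_eq_restrict_Ioc, ← intervalIntegral.integral_of_le zero_le_one,
    ← intervalIntegral.integral_of_le zero_le_one, intervalIntegral.integral_comp_add_right]
  rw [zero_add, add_comm 1 k, hf.intervalIntegral_add_eq k 0, zero_add]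

theorem continuous_integrableOn_Ioo {f : ℝ → ℝ} (hf : Continuous f) (a b : ℝ) :
    IntegrableOn f (Ioo a b) :=
  hf.integrableOn_Icc.mono_set Ioo_subset_Icc_self

/-- Summation by parts for difference quotients of periodic functions. -/
theorem integral_sub_mul_sub_of_periodic {d σ : ℝ → ℝ} (hd : Continuous d) (hσ : Continuous σ)
    (hdp : Function.Periodic d 1) (hσp : Function.Periodic σ 1) (k : ℝ) :
    ∫ x in Ioo (0 : ℝ) 1, (d (x + k) - d x) * (σ (x + k) - σ x) =
      -∫ x in Ioo (0 : ℝ) 1, d x * (σ (x + k) - 2 * σ x + σ (x - k)) := by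
  have h1 := setIntegral_Ioo_shift_of_periodic (f := fun x => d x * (σ x - σ (x - k)))
    (fun x => by
      simp only
      rw [hdp, hσp, show x + 1 - k = x - k + 1 by ring, hσp]) k
  simp only [add_sub_cancel_right] at h1
  have i1 : IntegrableOn (fun x => d (x + k) * (σ (x + k) - σ x)) (Ioo 0 1) :=
    continuous_integrableOn_Ioo (by fun_prop) _ _
  have i2 : IntegrableOn (fun x => d x * (σ (x + k) - σ x)) (Ioo 0 1) :=
    continuous_integrableOn_Ioo (by fun_prop) _ _
  have i3 : IntegrableOn (fun x => d x * (σ x - σ (x - k))) (Ioo 0 1) :=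
    continuous_integrableOn_Ioo (by fun_prop) _ _
  simp only [sub_mul]
  rw [integral_sub i1 i2, h1, ← integral_sub i3 i2, ← integral_neg]
  refine integral_congr_ae (Eventually.of_forall fun x => ?_)
  simp only
  ring

theorem ofReal_sq_integral_mul_le {α : Type*} [MeasurableSpace α] (μ : Measure α) {f g : α → ℝ}
    (hf : AEStronglyMeasurable f μ) (hg : AEStronglyMeasurable g μ) :
    ENNReal.ofReal ((∫ x, f x * g x ∂μ) ^ 2) ≤
      (∫⁻ x, ENNReal.ofReal (f x ^ 2) ∂μ) * ∫⁻ x, ENNReal.ofReal (g x ^ 2) ∂μ := by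
  have h1 := lintegral_mul_sq_le μ (f := fun x => ‖f x‖ₑ) (g := fun x => ‖g x‖ₑ) hf.enorm hg.enorm
  have h2 : ∀ y : ℝ, ENNReal.ofReal (y ^ 2) = ‖y‖ₑ ^ 2 := fun y => by
    rw [← sq_abs, ENNReal.ofReal_pow (abs_nonneg _), Real.enorm_eq_ofReal_abs]
  simp only [h2]
  refine le_trans (pow_le_pow_left' ?_ 2) h1
  refine (enorm_integral_le_lintegral_enorm _).trans_eq ?_
  simp only [enorm_mul]

theorem exists_forall_ge_of_continuous {f : ℝ → ℝ} (hf : Continuous f) {a b c : ℝ} (hab : a ≤ b)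
    (ha : f a ≤ c) (hb : c ≤ f b) : ∃ s ∈ Icc a b, f s = c ∧ ∀ t ∈ Icc s b, c ≤ f t := by
  have hne : (Icc a b ∩ f ⁻¹' {c}).Nonempty := by
    obtain ⟨s, hs, hsc⟩ := intermediate_value_Icc hab hf.continuousOn ⟨ha, hb⟩
    exact ⟨s, hs, hsc⟩
  have hcpt : IsCompact (Icc a b ∩ f ⁻¹' {c}) :=
    isCompact_Icc.inter_right (isClosed_singleton.preimage hf)
  -- `s` is the last time at the level `c`; a later value below `c` would force another crossing
  -- before `b`.
  obtain ⟨s, ⟨hs, hsc⟩, hmax⟩ := hcpt.exists_isGreatest hne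
  refine ⟨s, hs, hsc, fun t ht => ?_⟩
  by_contra hlt
  push Not at hlt
  obtain ⟨r, hr, hrc⟩ := intermediate_value_Icc ht.2 hf.continuousOn ⟨hlt.le, hb⟩
  have hrs : r ≤ s := hmax ⟨⟨hs.1.trans (ht.1.trans hr.1), hr.2⟩, hrc⟩
  have : t = s := le_antisymm (hr.1.trans hrs) ht.1
  rw [this] at hlt
  exact hlt.ne hsc

/-! ### A priori estimates in terms of `N`. -/

namespace EnergySolution

variable {T N : ℝ} {U : ℝ → ℝ → ℝ} {v : ℝ × ℝ → ℝ}

theorem continuous_slice (h : EnergySolution T N U v) (t : ℝ) : Continuous (U t) :=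
  h.continuous.comp (by fun_prop : Continuous fun x => (t, x))

theorem periodic_cube (h : EnergySolution T N U v) (t : ℝ) :
    Function.Periodic (fun x => U t x ^ 3) 1 := fun x => by
  simp only
  rw [h.periodic t x]

theorem lintegral_sq_second_difference_le (h : EnergySolution T N U v) {k : ℝ} (hk : 0 < k) :
    ∫⁻ p in Ioc 0 T ×ˢ Ioo 0 1, ENNReal.ofReal
      ((U p.1 (p.2 + k) ^ 3 - 2 * U p.1 p.2 ^ 3 + U p.1 (p.2 - k) ^ 3) ^ 2) ≤
        ENNReal.ofReal (k ^ 4 * (1 + N ^ 2)) := by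
  have hc1 : Continuous fun p : ℝ × ℝ => U p.1 (p.2 + k) :=
    h.continuous.comp (by fun_prop : Continuous fun p : ℝ × ℝ => (p.1, p.2 + k))
  have hc2 : Continuous fun p : ℝ × ℝ => U p.1 (p.2 - k) :=
    h.continuous.comp (by fun_prop : Continuous fun p : ℝ × ℝ => (p.1, p.2 - k))
  have hΔ : Continuous fun p : ℝ × ℝ =>
      U p.1 (p.2 + k) ^ 3 - 2 * U p.1 p.2 ^ 3 + U p.1 (p.2 - k) ^ 3 :=
    ((hc1.pow 3).sub (continuous_const.mul (h.continuous.pow 3))).add (hc2.pow 3)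
  have hm : Measurable fun p : ℝ × ℝ => ENNReal.ofReal
      ((U p.1 (p.2 + k) ^ 3 - 2 * U p.1 p.2 ^ 3 + U p.1 (p.2 - k) ^ 3) ^ 2) :=
    (hΔ.measurable.pow_const 2).ennreal_ofReal
  have hk4 : 0 ≤ k ^ 4 := by positivity
  have hslice : ∀ t, ∫⁻ x in Ioo (0 : ℝ) 1, ENNReal.ofReal
      ((U t (x + k) ^ 3 - 2 * U t x ^ 3 + U t (x - k) ^ 3) ^ 2) ≤
        ENNReal.ofReal (k ^ 4) * derivL2Sq 2 fun x => U t x ^ 3 := fun t =>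
    lintegral_sq_second_difference_le_derivL2Sq (f := fun x => U t x ^ 3)
      ((h.continuous_slice t).pow 3) (h.periodic_cube t) hk
  rw [restrict_Ioc_prod_Ioo, lintegral_prod _ hm.aemeasurable, ENNReal.ofReal_mul hk4]
  refine (lintegral_mono hslice).trans ?_
  rw [lintegral_const_mul' _ _ ENNReal.ofReal_ne_top]
  exact mul_le_mul' le_rfl h.energy

theorem integral_sq_sub_zero_le (h : EnergySolution T N U v) {k : ℝ} (hk : 0 < k) :
    ∫ x in Ioo (0 : ℝ) 1, (U 0 (x + k) ^ 3 - U 0 x ^ 3) ^ 2 ≤ k ^ 2 * N ^ 2 := by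
  have hc := h.continuous_slice 0
  have hi : IntegrableOn (fun x => (U 0 (x + k) ^ 3 - U 0 x ^ 3) ^ 2) (Ioo 0 1) :=
    continuous_integrableOn_Ioo (by fun_prop) _ _
  rw [← ENNReal.ofReal_le_ofReal_iff (by positivity),
    ofReal_integral_eq_lintegral_ofReal hi (Eventually.of_forall fun x => sq_nonneg _),
    ENNReal.ofReal_mul (by positivity)]
  refine (lintegral_sq_sub_le_derivL2Sq (f := fun x => U 0 x ^ 3) (hc.pow 3)
    (h.periodic_cube 0) hk).trans ?_
  gcongr
  exact le_trans le_add_self h.initial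

/-- The `H¹` estimate for the cube of a solution, in terms of difference quotients. -/
theorem integral_sq_sub_le (h : EnergySolution T N U v) {a : ℝ}
    (ha : ∀ t ∈ Icc 0 T, ∀ x ∈ Icc (0 : ℝ) 1, U t x ≤ a) {t : ℝ} (ht : t ∈ Icc 0 T) {k : ℝ}
    (hk : 0 < k) :
    ∫ x in Ioo (0 : ℝ) 1, (U t (x + k) ^ 3 - U t x ^ 3) ^ 2 ≤
      k ^ 2 * ((1 + N ^ 2) * (1 + 6 * a ^ 2)) := by
  have hUc := h.continuous
  have hUs := h.continuous_slice
  set Δ : ℝ → ℝ → ℝ := fun s x => U s (x + k) ^ 3 - 2 * U s x ^ 3 + U s (x - k) ^ 3 with hΔ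
  have hΔc : Continuous fun p : ℝ × ℝ => Δ p.1 p.2 := by
    have hc1 : Continuous fun p : ℝ × ℝ => U p.1 (p.2 + k) :=
      h.continuous.comp (by fun_prop : Continuous fun p : ℝ × ℝ => (p.1, p.2 + k))
    have hc2 : Continuous fun p : ℝ × ℝ => U p.1 (p.2 - k) :=
      h.continuous.comp (by fun_prop : Continuous fun p : ℝ × ℝ => (p.1, p.2 - k))
    exact ((hc1.pow 3).sub (continuous_const.mul (h.continuous.pow 3))).add (hc2.pow 3)
  -- A difference of squares, summation by parts and $y^3-z^3=(y-z)(y^2+yz+z^2)$ factor the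
  -- increment of `q` exactly through that of `U`. On the diagonal the kernel is $-3U^2\Delta$, the
  -- discrete form of $-3u^2w_{hh}$.
  set K : ℝ → ℝ → ℝ → ℝ := fun s τ x =>
    -((U τ x ^ 2 + U τ x * U s x + U s x ^ 2) * ((Δ s x + Δ τ x) / 2)) with hKdef
  have hK : Continuous fun p : ℝ × ℝ × ℝ => K p.1 p.2.1 p.2.2 := by
    have c1 : Continuous fun p : ℝ × ℝ × ℝ => U p.1 p.2.2 :=
      hUc.comp (by fun_prop : Continuous fun p : ℝ × ℝ × ℝ => (p.1, p.2.2))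
    have c2 : Continuous fun p : ℝ × ℝ × ℝ => U p.2.1 p.2.2 := hUc.comp continuous_snd
    have c3 : Continuous fun p : ℝ × ℝ × ℝ => Δ p.1 p.2.2 :=
      hΔc.comp (by fun_prop : Continuous fun p : ℝ × ℝ × ℝ => (p.1, p.2.2))
    have c4 : Continuous fun p : ℝ × ℝ × ℝ => Δ p.2.1 p.2.2 := hΔc.comp continuous_snd
    exact ((((c2.pow 2).add (c2.mul c1)).add (c1.pow 2)).mul ((c3.add c4).div_const 2)).neg
  set q : ℝ → ℝ := fun s => (∫ x in Ioo (0 : ℝ) 1, (U s (x + k) ^ 3 - U s x ^ 3) ^ 2) / 2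
  have hq : ∀ s τ, 0 ≤ s → s ≤ τ → τ ≤ t →
      q τ - q s = ∫ x in Ioo (0 : ℝ) 1, (U τ x - U s x) * K s τ x := by
    intro s τ _ _ _
    have hs := hUs s
    have hτ := hUs τ
    have i1 : ∀ r, IntegrableOn (fun x => (U r (x + k) ^ 3 - U r x ^ 3) ^ 2) (Ioo 0 1) := fun r => by
      have hr := hUs r
      exact continuous_integrableOn_Ioo (by fun_prop) _ _
    have parts := integral_sub_mul_sub_of_periodic (d := fun x => U τ x ^ 3 - U s x ^ 3)
      (σ := fun x => U τ x ^ 3 + U s x ^ 3) (by fun_prop) (by fun_prop)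
      ((h.periodic_cube τ).sub (h.periodic_cube s)) ((h.periodic_cube τ).add (h.periodic_cube s)) k
    have e1 : q τ - q s = (∫ x in Ioo (0 : ℝ) 1, ((U τ (x + k) ^ 3 - U s (x + k) ^ 3) -
        (U τ x ^ 3 - U s x ^ 3)) * ((U τ (x + k) ^ 3 + U s (x + k) ^ 3) -
        (U τ x ^ 3 + U s x ^ 3))) / 2 := by
      simp only [q]
      rw [← sub_div, ← integral_sub (i1 τ) (i1 s)]
      congr 1
      refine integral_congr_ae (Eventually.of_forall fun x => ?_)
      simp only
      ring
    rw [e1, parts, ← integral_neg, ← integral_div]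
    refine integral_congr_ae (Eventually.of_forall fun x => ?_)
    simp only [hKdef, hΔ]
    ring
  have hsub : Ioc 0 t ×ˢ Ioo (0 : ℝ) 1 ⊆ Ioc 0 T ×ˢ Ioo 0 1 :=
    prod_mono_left (Ioc_subset_Ioc_right ht.2)
  have hvt := h.integrable.mono_set hsub
  have main := sub_eq_integral_of_increment ht.1 hvt
    (fun s τ hs hst hτ ψ hψ => h.increment s τ hs hst (hτ.trans ht.2) ψ hψ) hK hq
  have hKd : ∀ p : ℝ × ℝ, K p.1 p.1 p.2 = -(3 * U p.1 p.2 ^ 2 * Δ p.1 p.2) := fun p => by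
    simp only [hKdef]
    ring
  simp only [hKd] at main
  have hmeas : MeasurableSet (Ioc 0 t ×ˢ Ioo (0 : ℝ) 1) := measurableSet_Ioc.prod measurableSet_Ioo
  have hgc : Continuous fun p : ℝ × ℝ => -(3 * U p.1 p.2 ^ 2 * Δ p.1 p.2) :=
    ((continuous_const.mul (hUc.pow 2)).mul hΔc).neg
  have hcs := ofReal_sq_integral_mul_le (volume.restrict (Ioc 0 t ×ˢ Ioo (0 : ℝ) 1))
    hvt.aestronglyMeasurable hgc.aestronglyMeasurable
  rw [← main] at hcs
  have hΔint : ∫⁻ p in Ioc 0 t ×ˢ Ioo (0 : ℝ) 1,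
      ENNReal.ofReal ((-(3 * U p.1 p.2 ^ 2 * Δ p.1 p.2)) ^ 2) ≤
        ENNReal.ofReal (9 * a ^ 4 * (k ^ 4 * (1 + N ^ 2))) := by
    calc _ ≤ ∫⁻ p in Ioc 0 t ×ˢ Ioo (0 : ℝ) 1,
          ENNReal.ofReal (9 * a ^ 4) * ENNReal.ofReal (Δ p.1 p.2 ^ 2) := by
          refine setLIntegral_mono' hmeas fun p hp => ?_
          rw [← ENNReal.ofReal_mul (by positivity)]
          refine ENNReal.ofReal_le_ofReal ?_
          have h4 : U p.1 p.2 ^ 4 ≤ a ^ 4 := pow_le_pow_left₀ (h.nonneg _ _)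
            (ha p.1 ⟨hp.1.1.le, hp.1.2.trans ht.2⟩ p.2 (Ioo_subset_Icc_self hp.2)) 4
          calc _ = 9 * U p.1 p.2 ^ 4 * Δ p.1 p.2 ^ 2 := by ring
            _ ≤ _ := by gcongr
      _ = ENNReal.ofReal (9 * a ^ 4) *
          ∫⁻ p in Ioc 0 t ×ˢ Ioo (0 : ℝ) 1, ENNReal.ofReal (Δ p.1 p.2 ^ 2) :=
          lintegral_const_mul' _ _ ENNReal.ofReal_ne_top
      _ ≤ _ := by
          rw [ENNReal.ofReal_mul (by positivity : 0 ≤ 9 * a ^ 4)]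
          gcongr
          exact (lintegral_mono_set hsub).trans (h.lintegral_sq_second_difference_le hk)
  have hle : (q t - q 0) ^ 2 ≤ N ^ 2 * (9 * a ^ 4 * (k ^ 4 * (1 + N ^ 2))) := by
    rw [← ENNReal.ofReal_le_ofReal_iff (by positivity), ENNReal.ofReal_mul (sq_nonneg N)]
    exact hcs.trans (mul_le_mul' ((lintegral_mono_set hsub).trans h.velocity) hΔint)
  -- Replacing $N^2$ by $1+N^2$ makes the right-hand side a perfect square.
  have hle2 : (q t - q 0) ^ 2 ≤ (3 * a ^ 2 * k ^ 2 * (1 + N ^ 2)) ^ 2 := by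
    refine hle.trans ?_
    have : 0 ≤ 9 * a ^ 4 * k ^ 4 * (1 + N ^ 2) := by positivity
    nlinarith
  have hle3 := (abs_le_of_sq_le_sq' hle2 (by positivity)).2
  have h0 := h.integral_sq_sub_zero_le hk
  have hk2 : 0 ≤ k ^ 2 := sq_nonneg k
  simp only [q] at hle3
  nlinarith

theorem sq_cube_sub_le (h : EnergySolution T N U v) {a : ℝ}
    (ha : ∀ t ∈ Icc 0 T, ∀ x ∈ Icc (0 : ℝ) 1, U t x ≤ a) {t : ℝ} (ht : t ∈ Icc 0 T) {x y : ℝ}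
    (hx : x ∈ Icc (0 : ℝ) 1) (hy : y ∈ Icc (0 : ℝ) 1) :
    (U t x ^ 3 - U t y ^ 3) ^ 2 ≤ (1 + N ^ 2) * (1 + 6 * a ^ 2) * |x - y| := by
  have hc := h.continuous_slice t
  refine sq_sub_le_of_lintegral_sq_sub_le (f := fun x => U t x ^ 3) (hc.pow 3) (by positivity)
    (fun k hk => ?_) hx hy
  have hi : IntegrableOn (fun x => (U t (x + k) ^ 3 - U t x ^ 3) ^ 2) (Ioo 0 1) :=
    continuous_integrableOn_Ioo (by fun_prop) _ _
  rw [← ofReal_integral_eq_lintegral_ofReal hi (Eventually.of_forall fun x => sq_nonneg _)]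
  exact ENNReal.ofReal_le_ofReal (h.integral_sq_sub_le ha ht hk)

/-- The Sobolev embedding gives $w^2\le2N^2\le(1+N^2)^2$ at time $0$. -/
theorem cube_zero_le (h : EnergySolution T N U v) (x : ℝ) : U 0 x ^ 3 ≤ 1 + N ^ 2 := by
  have h1 : ENNReal.ofReal ((U 0 x ^ 3) ^ 2) ≤ ENNReal.ofReal (2 * N ^ 2) := by
    rw [ENNReal.ofReal_mul zero_le_two, ENNReal.ofReal_ofNat]
    exact (ofReal_sq_le_derivL2Sq ((h.continuous_slice 0).pow 3) (h.periodic_cube 0) x).trans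
      (mul_le_mul' le_rfl h.initial)
  rw [ENNReal.ofReal_le_ofReal_iff (by positivity)] at h1
  refine abs_le_of_sq_le_sq' ?_ (by positivity) |>.2
  nlinarith [sq_nonneg (N ^ 2)]

/-- While a solution is positive, the integral of its reciprocal is conserved. -/
theorem integral_inv_eq (h : EnergySolution T N U v) {a b c : ℝ} (ha : 0 ≤ a) (hab : a ≤ b)
    (hb : b ≤ T) (hc : 0 < c) (hU : ∀ t ∈ Icc a b, ∀ x, c ≤ U t x) :
    ∫ x in Ioo (0 : ℝ) 1, (U a x)⁻¹ = ∫ x in Ioo (0 : ℝ) 1, (U b x)⁻¹ := by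
  -- Truncating below by `c` changes nothing on $[a,b]$ and makes the kernel $-1/(V_sV_t)$, which
  -- comes from $\frac1{V_t}-\frac1{V_s}$, continuous at all times.
  set V : ℝ → ℝ → ℝ := fun t x => max (U t x) c
  have hV0 : ∀ t x, 0 < V t x := fun t x => lt_max_of_lt_right hc
  have hVU : ∀ t ∈ Icc a b, ∀ x, V t x = U t x := fun t ht x => max_eq_left (hU t ht x)
  have hVc : Continuous fun p : ℝ × ℝ => V p.1 p.2 := h.continuous.max continuous_const
  have hVs : ∀ t, Continuous (V t) := fun t => hVc.comp (by fun_prop : Continuous fun x => (t, x))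
  have hsub : Ioc a b ×ˢ Ioo (0 : ℝ) 1 ⊆ Ioc 0 T ×ˢ Ioo 0 1 :=
    prod_mono_left (Ioc_subset_Ioc ha hb)
  have hK : Continuous fun p : ℝ × ℝ × ℝ => -(V p.1 p.2.2 * V p.2.1 p.2.2)⁻¹ := by
    have c1 : Continuous fun p : ℝ × ℝ × ℝ => V p.1 p.2.2 :=
      hVc.comp (by fun_prop : Continuous fun p : ℝ × ℝ × ℝ => (p.1, p.2.2))
    have c2 : Continuous fun p : ℝ × ℝ × ℝ => V p.2.1 p.2.2 := hVc.comp continuous_snd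
    exact ((c1.mul c2).inv₀ fun p => (mul_pos (hV0 _ _) (hV0 _ _)).ne').neg
  have main := sub_eq_integral_of_increment hab (h.integrable.mono_set hsub)
    (fun s τ hs hst hτ ψ hψ => h.increment s τ (ha.trans hs) hst (hτ.trans hb) ψ hψ)
    (K := fun s τ x => -(V s x * V τ x)⁻¹) hK (q := fun t => ∫ x in Ioo (0 : ℝ) 1, (V t x)⁻¹)
    fun s τ hs hst hτ => by
      have i : ∀ r, IntegrableOn (fun x => (V r x)⁻¹) (Ioo 0 1) := fun r =>
        continuous_integrableOn_Ioo ((hVs r).inv₀ fun x => (hV0 r x).ne') _ _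
      rw [← integral_sub (i τ) (i s)]
      refine integral_congr_ae (Eventually.of_forall fun x => ?_)
      simp only
      rw [← hVU τ ⟨hs.trans hst, hτ⟩, ← hVU s ⟨hs, hst.trans hτ⟩]
      have := (hV0 s x).ne'
      have := (hV0 τ x).ne'
      field_simp
      ring
  have hz := h.reciprocal a b ha hab hb fun t ht x => hc.trans_le (hU t ht x)
  have e : ∫ p in Ioc a b ×ˢ Ioo (0 : ℝ) 1, v p * -(V p.1 p.2 * V p.1 p.2)⁻¹ = 0 := by
    calc _ = ∫ p in Ioc a b ×ˢ Ioo (0 : ℝ) 1, -(v p * (U p.1 p.2 ^ 2)⁻¹) := by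
          refine setIntegral_congr_fun (measurableSet_Ioc.prod measurableSet_Ioo) fun p hp => ?_
          rw [hVU p.1 (Ioc_subset_Icc_self hp.1)]
          ring
      _ = 0 := by rw [integral_neg, hz, neg_zero]
  rw [e] at main
  simp only [hVU b ⟨hab, le_rfl⟩, hVU a ⟨le_rfl, hab⟩] at main
  linarith

/-- The maximum of a solution is bounded in terms of the initial data, uniformly in time. -/
theorem le_bound (h : EnergySolution T N U v) {t x : ℝ} (ht : t ∈ Icc 0 T)
    (hx : x ∈ Icc (0 : ℝ) 1) : U t x ≤ 448 * (1 + N ^ 2) := by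
  by_contra hlt
  push Not at hlt
  -- The space-time maximum `a`, attained at time `b` and position `y`, also serves as the upper
  -- bound in the Hölder estimate.
  obtain ⟨⟨b, y⟩, ⟨hb, hy⟩, hmax⟩ := (isCompact_Icc.prod isCompact_Icc).exists_isMaxOn
    (⟨(t, x), ht, hx⟩ : (Icc 0 T ×ˢ Icc (0 : ℝ) 1).Nonempty) h.continuous.continuousOn
  simp only at hb hy
  set a := U b y with ha
  have hle : ∀ t ∈ Icc 0 T, ∀ x ∈ Icc (0 : ℝ) 1, U t x ≤ a := fun t ht x hx =>
    isMaxOn_iff.1 hmax (t, x) ⟨ht, hx⟩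
  have ha0 : 448 * (1 + N ^ 2) < a := hlt.trans_le (hle t ht x hx)
  have hN2 : 0 ≤ N ^ 2 := sq_nonneg N
  have ha1 : 1 ≤ a := by linarith
  have ha2 : 1 ≤ a ^ 2 := one_le_pow₀ ha1
  have ha3 : a ≤ a ^ 3 := by nlinarith
  have hosc : ∀ t ∈ Icc 0 T, ∀ x ∈ Icc (0 : ℝ) 1, |U t x ^ 3 - U t y ^ 3| ≤ a ^ 3 / 8 := by
    intro t ht x hx
    refine abs_le_of_sq_le_sq ?_ (by positivity)
    refine (h.sq_cube_sub_le hle ht hx hy).trans ?_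
    have h1 : |x - y| ≤ 1 := by
      rw [abs_le]
      constructor <;> linarith [hx.1, hx.2, hy.1, hy.2]
    -- Here $448=7\cdot64$: with $1+6a^2\le7a^2$ the squared oscillation is at most
    -- $a^3/64\le(a^3/8)^2$.
    have h2 : (1 + N ^ 2) * (1 + 6 * a ^ 2) ≤ (a / 448) * (7 * a ^ 2) := by
      refine mul_le_mul (by linarith) (by linarith) (by positivity) (by positivity)
    have h3 : (a / 448) * (7 * a ^ 2) = a ^ 3 / 64 := by ring
    have h4 : a ^ 3 ≤ (a ^ 3) ^ 2 := by nlinarith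
    calc _ ≤ (a ^ 3 / 64) * 1 := by
          rw [← h3]
          exact mul_le_mul h2 h1 (abs_nonneg _) (by positivity)
      _ ≤ _ := by rw [mul_one, div_pow]; linarith
  have hf : Continuous fun t => U t y ^ 3 :=
    (h.continuous.comp (by fun_prop : Continuous fun t : ℝ => (t, y))).pow 3
  -- The cube starts below $1+N^2\le a^3/2$ and reaches $a^3$ at time `b`; `s` is its last passage
  -- through $a^3/2$ at `y`.
  obtain ⟨s, hs, hsc, hge⟩ := exists_forall_ge_of_continuous hf (c := a ^ 3 / 2) hb.1
    (by linarith [h.cube_zero_le y]) (by simp only [← ha]; linarith)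
  have hsT : s ∈ Icc 0 T := ⟨hs.1, hs.2.trans hb.2⟩
  -- On $[s,b]$ the cube is at least $\frac12a^3-\frac18a^3\ge(a/2)^3$ everywhere, so conservation
  -- of $\int 1/U$ applies.
  have hlow : ∀ t ∈ Icc s b, ∀ x, a / 2 ≤ U t x := by
    intro t ht x
    have htT : t ∈ Icc 0 T := ⟨hs.1.trans ht.1, ht.2.trans hb.2⟩
    have hfr : U t x = U t (Int.fract x) := by
      have := (h.periodic t).sub_zsmul_eq ⌊x⌋ (x := x)
      rw [zsmul_one] at this
      exact this.symm
    rw [hfr]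
    have h1 := abs_le.1 (hosc t htT (Int.fract x) ⟨Int.fract_nonneg x, (Int.fract_lt_one x).le⟩)
    have h2 := hge t ht
    refine le_of_pow_le_pow_left₀ three_ne_zero (h.nonneg _ _) ?_
    rw [div_pow]
    linarith [h1.1]
  have hcons := h.integral_inv_eq hs.1 hs.2 hb.2 (by linarith : 0 < a / 2) hlow
  -- The cube is at most $\frac58a^3$ at time `s` and at least $\frac78a^3$ at time `b`.
  have hlt' : ∀ x ∈ Icc (0 : ℝ) 1, U s x < U b x := by
    intro x hx
    refine lt_of_pow_lt_pow_left₀ 3 (h.nonneg _ _) ?_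
    have h1 := (abs_le.1 (hosc s hsT x hx)).2
    have h2 := (abs_le.1 (hosc b hb x hx)).1
    rw [hsc] at h1
    rw [← ha] at h2
    linarith
  have hpos : ∀ t ∈ Icc s b, ∀ x, 0 < U t x := fun t ht x =>
    (by linarith : 0 < a / 2).trans_le (hlow t ht x)
  have hsI : s ∈ Icc s b := ⟨le_rfl, hs.2⟩
  have hbI : b ∈ Icc s b := ⟨hs.2, le_rfl⟩
  have hinv : ∀ x ∈ Icc (0 : ℝ) 1, (U b x)⁻¹ < (U s x)⁻¹ := fun x hx =>
    inv_strictAnti₀ (hpos s hsI x) (hlt' x hx)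
  have := intervalIntegral.integral_lt_integral_of_continuousOn_of_le_of_exists_lt
    (zero_lt_one (α := ℝ))
    ((h.continuous_slice b).inv₀ fun x => (hpos b hbI x).ne').continuousOn
    ((h.continuous_slice s).inv₀ fun x => (hpos s hsI x).ne').continuousOn
    (fun x hx => (hinv x (Ioc_subset_Icc_self hx)).le)
    ⟨0, ⟨le_rfl, zero_le_one⟩, hinv 0 ⟨le_rfl, zero_le_one⟩⟩
  rw [intervalIntegral.integral_of_le zero_le_one, intervalIntegral.integral_of_le zero_le_one,
    ← restrict_Ioo_eq_restrict_Ioc] at this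
  exact this.ne hcons.symm

/-- Pair the increment with itself: Cauchy–Schwarz gives $I^2\le N^2(t-s)I$, and one factor $I$
cancels. -/
theorem integral_sq_sub_time_le (h : EnergySolution T N U v) {s t : ℝ} (hs : 0 ≤ s) (hst : s ≤ t)
    (ht : t ≤ T) : ∫ x in Ioo (0 : ℝ) 1, (U t x - U s x) ^ 2 ≤ N ^ 2 * (t - s) := by
  set g : ℝ → ℝ := fun x => U t x - U s x with hg
  have hgc : Continuous g := (h.continuous_slice t).sub (h.continuous_slice s)
  have hgi : IntegrableOn (fun x => g x ^ 2) (Ioo 0 1) := continuous_integrableOn_Ioo (hgc.pow 2) _ _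
  have hsub : Ioc s t ×ˢ Ioo (0 : ℝ) 1 ⊆ Ioc 0 T ×ˢ Ioo 0 1 :=
    prod_mono_left (Ioc_subset_Ioc hs ht)
  set I := ∫ x in Ioo (0 : ℝ) 1, g x ^ 2
  have hI : 0 ≤ I := integral_nonneg fun x => sq_nonneg _
  have e := h.increment s t hs hst ht g hgc
  have e1 : I = ∫ p in Ioc s t ×ˢ Ioo 0 1, v p * g p.2 := by
    rw [← e]
    refine integral_congr_ae (Eventually.of_forall fun x => ?_)
    simp only [hg]
    ring
  have hcs := ofReal_sq_integral_mul_le (volume.restrict (Ioc s t ×ˢ Ioo (0 : ℝ) 1))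
    (h.integrable.mono_set hsub).aestronglyMeasurable
    (g := fun p : ℝ × ℝ => g p.2) (hgc.comp continuous_snd).aestronglyMeasurable
  have e2 : ∫⁻ p in Ioc s t ×ˢ Ioo (0 : ℝ) 1, ENNReal.ofReal (g p.2 ^ 2) =
      ENNReal.ofReal ((t - s) * I) := by
    have hm : Measurable fun p : ℝ × ℝ => ENNReal.ofReal (g p.2 ^ 2) :=
      ((hgc.comp continuous_snd).pow 2).measurable.ennreal_ofReal
    rw [restrict_Ioc_prod_Ioo, lintegral_prod _ hm.aemeasurable]
    simp only [lintegral_const, Measure.restrict_apply_univ, Real.volume_Ioc]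
    rw [← ofReal_integral_eq_lintegral_ofReal hgi (Eventually.of_forall fun x => sq_nonneg _),
      ENNReal.ofReal_mul (by linarith), mul_comm]
  rw [← e1, e2] at hcs
  have h1 : I ^ 2 ≤ N ^ 2 * ((t - s) * I) := by
    have : 0 ≤ t - s := by linarith
    rw [← ENNReal.ofReal_le_ofReal_iff (by positivity), ENNReal.ofReal_mul (sq_nonneg N)]
    exact hcs.trans (mul_le_mul' ((lintegral_mono_set hsub).trans h.velocity) le_rfl)
  rcases hI.eq_or_lt with h0 | h0
  · rw [← h0]
    have : 0 ≤ t - s := by linarith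
    positivity
  · nlinarith

theorem exists_holderOnWith (h : EnergySolution T N U v) {t : ℝ} (ht : t ∈ Icc 0 T) :
    ∃ K : NNReal, HolderOnWith K (1 / 2) (fun x => U t x ^ 3) (Icc 0 1) := by
  set B := (1 + N ^ 2) * (1 + 6 * (448 * (1 + N ^ 2)) ^ 2)
  have hB : 0 ≤ B := by positivity
  refine ⟨(√B).toNNReal, fun x hx y hy => ?_⟩
  have h1 := Real.abs_le_sqrt (h.sq_cube_sub_le (fun t ht x hx => h.le_bound ht hx) ht hx hy)
  rw [Real.sqrt_mul hB, Real.sqrt_eq_rpow |x - y|] at h1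
  rw [edist_dist, edist_dist, Real.dist_eq, Real.dist_eq,
    ENNReal.ofReal_rpow_of_nonneg (abs_nonneg _) (by positivity)]
  refine (ENNReal.ofReal_le_ofReal h1).trans_eq ?_
  rw [ENNReal.ofReal_mul (Real.sqrt_nonneg _)]
  simp [ENNReal.ofReal]

end EnergySolution

/-! ### Hölder continuity in time, and the conclusion. -/

/-- Interpolation between Hölder continuity and the mean square. -/
theorem sq_le_of_integral_sq_le {f : ℝ → ℝ} (hf : Continuous f) {x D δ r : ℝ}
    (hx : x ∈ Icc (0 : ℝ) 1) (hD : 0 ≤ D)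
    (hH : ∀ y ∈ Icc (0 : ℝ) 1, (f x - f y) ^ 2 ≤ D * |x - y|)
    (hδ : ∫ y in Ioo (0 : ℝ) 1, f y ^ 2 ≤ δ) (hr : 0 < r) (hr' : r ≤ 1 / 2) :
    f x ^ 2 ≤ 2 * δ / r + 2 * D * r := by
  -- Since $r\le1/2$, an interval of length `r` with end point `x` fits into $[0,1]$ on at least one
  -- side; $f(x)^2$ is averaged over it.
  obtain ⟨c, hc0, hc1, hc⟩ : ∃ c, 0 ≤ c ∧ c + r ≤ 1 ∧ ∀ y ∈ Icc c (c + r), |x - y| ≤ r := by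
    rcases le_total x (1 / 2) with h | h
    · refine ⟨x, hx.1, by linarith, fun y hy => ?_⟩
      rw [abs_le]
      constructor <;> linarith [hy.1, hy.2]
    · refine ⟨x - r, by linarith, by linarith [hx.2], fun y hy => ?_⟩
      rw [abs_le]
      constructor <;> linarith [hy.1, hy.2]
  have h1 : ∫ _ in c..c + r, f x ^ 2 ≤ ∫ y in c..c + r, (2 * f y ^ 2 + 2 * D * r) := by
    refine intervalIntegral.integral_mono_on (by linarith) (by simp)
      ((by fun_prop : Continuous fun y => 2 * f y ^ 2 + 2 * D * r).intervalIntegrable _ _)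
      fun y hy => ?_
    have h2 := hH y ⟨hc0.trans hy.1, hy.2.trans hc1⟩
    have h3 : D * |x - y| ≤ D * r := mul_le_mul_of_nonneg_left (hc y hy) hD
    nlinarith [sq_nonneg (f x - 2 * f y)]
  have h4 : ∫ y in c..c + r, f y ^ 2 ≤ δ := by
    refine le_trans ?_ hδ
    rw [intervalIntegral.integral_of_le (by linarith), ← restrict_Ioo_eq_restrict_Ioc]
    exact setIntegral_mono_set (continuous_integrableOn_Ioo (hf.pow 2) _ _)
      (Eventually.of_forall fun y => sq_nonneg _) (Ioo_subset_Ioo hc0 hc1).eventuallyLE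
  rw [intervalIntegral.integral_add ((by fun_prop : Continuous fun y =>
    2 * f y ^ 2).intervalIntegrable _ _) (by simp), intervalIntegral.integral_const_mul,
    intervalIntegral.integral_const, intervalIntegral.integral_const, add_sub_cancel_left,
    smul_eq_mul, smul_eq_mul] at h1
  have h5 : r * f x ^ 2 ≤ 2 * δ + r * (2 * D * r) := by linarith
  have h6 : 2 * δ / r + 2 * D * r = (2 * δ + r * (2 * D * r)) / r := by field_simp
  rw [h6, le_div_iff₀ hr]
  linarith

theorem EnergySolution.abs_cube_sub_le {T N : ℝ} {U : ℝ → ℝ → ℝ} {v : ℝ × ℝ → ℝ}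
    (h : EnergySolution T N U v) {a : ℝ}
    (ha : ∀ t ∈ Icc 0 T, ∀ x ∈ Icc (0 : ℝ) 1, U t x ≤ a) {s t x : ℝ} (hs : 0 ≤ s) (hst : s ≤ t)
    (ht : t ≤ T) (hx : x ∈ Icc (0 : ℝ) 1) :
    |U t x ^ 3 - U s x ^ 3| ≤
      √(18 * a ^ 4 * N ^ 2 + 8 * ((1 + N ^ 2) * (1 + 6 * a ^ 2)) + 2 * a ^ 6) *
        (t - s) ^ (1 / 4 : ℝ) := by
  have hsT : s ∈ Icc 0 T := ⟨hs, hst.trans ht⟩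
  have htT : t ∈ Icc 0 T := ⟨hs.trans hst, ht⟩
  set B := (1 + N ^ 2) * (1 + 6 * a ^ 2)
  have hB : 0 ≤ B := by positivity
  set Q := 18 * a ^ 4 * N ^ 2 + 8 * B + 2 * a ^ 6
  have hτ : 0 ≤ t - s := by linarith
  set f : ℝ → ℝ := fun x => U t x ^ 3 - U s x ^ 3 with hf
  have hsc := h.continuous_slice s
  have htc := h.continuous_slice t
  have hfc : Continuous f := by fun_prop
  have key : f x ^ 2 ≤ Q * √(t - s) := by
    have ha6 : 0 ≤ a ^ 6 := by positivity
    rcases hτ.eq_or_lt with h0 | h0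
    · have : t = s := by linarith
      simp [hf, this]
    rcases le_or_gt (t - s) (1 / 4) with hle | hgt
    -- The interval length $r=\sqrt{t-s}$ balances the mean-square term $(t-s)/r$ against the Hölder
    -- term $r$; it is at most $1/2$ because $t-s\le1/4$.
    · have hr : 0 < √(t - s) := Real.sqrt_pos.2 h0
      have hr' : √(t - s) ≤ 1 / 2 := Real.sqrt_le_iff.2 ⟨by norm_num, by linarith⟩
      have hint : ∫ y in Ioo (0 : ℝ) 1, f y ^ 2 ≤ 9 * a ^ 4 * (N ^ 2 * (t - s)) := by
        calc _ ≤ ∫ y in Ioo (0 : ℝ) 1, 9 * a ^ 4 * (U t y - U s y) ^ 2 := by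
              refine setIntegral_mono_on (continuous_integrableOn_Ioo (by fun_prop) _ _)
                (continuous_integrableOn_Ioo (by fun_prop) _ _) measurableSet_Ioo fun y hy => ?_
              have hyI := Ioo_subset_Icc_self hy
              have b1 := ha t htT y hyI
              have b2 := ha s hsT y hyI
              have n1 := h.nonneg t y
              have n2 := h.nonneg s y
              have a0 : 0 ≤ a := n1.trans b1
              have c1 : U t y ^ 2 + U t y * U s y + U s y ^ 2 ≤ 3 * a ^ 2 := by
                nlinarith [mul_le_mul b1 b1 n1 a0, mul_le_mul b1 b2 n2 a0,
                  mul_le_mul b2 b2 n2 a0]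
              have c2 : 0 ≤ U t y ^ 2 + U t y * U s y + U s y ^ 2 := by positivity
              calc f y ^ 2 = (U t y ^ 2 + U t y * U s y + U s y ^ 2) ^ 2 *
                    (U t y - U s y) ^ 2 := by simp only [hf]; ring
                _ ≤ (3 * a ^ 2) ^ 2 * (U t y - U s y) ^ 2 := by gcongr
                _ = _ := by ring
          _ = 9 * a ^ 4 * ∫ y in Ioo (0 : ℝ) 1, (U t y - U s y) ^ 2 := integral_const_mul _ _
          _ ≤ _ := by
              gcongr
              exact h.integral_sq_sub_time_le hs hst ht
      have hH : ∀ y ∈ Icc (0 : ℝ) 1, (f x - f y) ^ 2 ≤ 4 * B * |x - y| := by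
        intro y hy
        have h1 := h.sq_cube_sub_le ha htT hx hy
        have h2 := h.sq_cube_sub_le ha hsT hx hy
        simp only [hf]
        nlinarith [sq_nonneg ((U t x ^ 3 - U t y ^ 3) + (U s x ^ 3 - U s y ^ 3))]
      have := sq_le_of_integral_sq_le hfc hx (by positivity) hH hint hr hr'
      have e : 2 * (9 * a ^ 4 * (N ^ 2 * (t - s))) / √(t - s) =
          18 * a ^ 4 * N ^ 2 * √(t - s) := by
        rw [div_eq_iff hr.ne']
        linear_combination (-(18 * a ^ 4 * N ^ 2)) * Real.mul_self_sqrt hτ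
      rw [e] at this
      have : 0 ≤ 2 * a ^ 6 * √(t - s) := by positivity
      simp only [Q]
      nlinarith
    -- For longer times the trivial bound $|f|\le a^3$ suffices; this accounts for the term $2a^6$
    -- in the constant.
    · have hr : 1 / 2 ≤ √(t - s) := Real.le_sqrt_of_sq_le (by linarith)
      have p1 : U t x ^ 3 ≤ a ^ 3 := pow_le_pow_left₀ (h.nonneg _ _) (ha t htT x hx) 3
      have p2 : U s x ^ 3 ≤ a ^ 3 := pow_le_pow_left₀ (h.nonneg _ _) (ha s hsT x hx) 3
      have q1 : 0 ≤ U t x ^ 3 := pow_nonneg (h.nonneg _ _) 3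
      have q2 : 0 ≤ U s x ^ 3 := pow_nonneg (h.nonneg _ _) 3
      have h1 : f x ^ 2 ≤ (a ^ 3) ^ 2 := by
        rw [sq_le_sq, abs_of_nonneg (q1.trans p1), abs_le]
        simp only [hf]
        constructor <;> linarith
      have h2 : 2 * a ^ 6 ≤ Q := by
        have : 0 ≤ 18 * a ^ 4 * N ^ 2 := by positivity
        simp only [Q]
        linarith
      calc f x ^ 2 ≤ 2 * a ^ 6 * (1 / 2) := by linarith
        _ ≤ _ := by gcongr
  have hQ : 0 ≤ Q := by positivity
  have e : √(Q * √(t - s)) = √Q * (t - s) ^ (1 / 4 : ℝ) := by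
    rw [Real.sqrt_mul hQ, Real.sqrt_eq_rpow √(t - s), Real.sqrt_eq_rpow (t - s),
      ← Real.rpow_mul hτ]
    norm_num
  rw [← e]
  exact Real.abs_le_sqrt key

end Vicinal

theorem mainTheorem4 :
    ∃ C : ℝ → ℝ, ∀ (T : ℝ) (_ : 0 < T) (u₀ : ℝ → ℝ) (_ : Vicinal.AdmissibleData u₀)
      (u : ℝ → ℝ → ℝ) (_ : Vicinal.IsWeakSolution T u₀ u),
      (∀ t₁ ∈ Set.Icc 0 T, ∀ t₂ ∈ Set.Icc 0 T, ∀ h ∈ Set.Icc (0 : ℝ) 1,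
        |u t₁ h ^ 3 - u t₂ h ^ 3| ≤
          C (Vicinal.sobolevNorm 2 (fun x => u₀ x ^ 3)).toReal * |t₂ - t₁| ^ (1 / 4 : ℝ)) ∧
      (∀ t ∈ Set.Icc 0 T, ∃ K : NNReal,
        HolderOnWith K (1 / 2) (fun h => u t h ^ 3) (Set.Icc 0 1)) := by
  -- The constant of `abs_cube_sub_le` at $a=448(1+N^2)$, the bound of `le_bound`.
  refine ⟨fun N => √(18 * (448 * (1 + N ^ 2)) ^ 4 * N ^ 2 +
    8 * ((1 + N ^ 2) * (1 + 6 * (448 * (1 + N ^ 2)) ^ 2)) + 2 * (448 * (1 + N ^ 2)) ^ 6),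
    fun T hT u₀ h₀ u hu => ?_⟩
  obtain ⟨U, v, hU, hUu⟩ := hu.exists_energySolution hT h₀.2.1
  refine ⟨fun t₁ h₁ t₂ h₂ x hx => ?_, fun t ht => ?_⟩
  · rw [← hUu t₁ h₁, ← hUu t₂ h₂]
    rcases le_total t₁ t₂ with h | h
    · rw [abs_sub_comm, abs_of_nonneg (sub_nonneg.2 h)]
      exact hU.abs_cube_sub_le (fun t ht x hx => hU.le_bound ht hx) h₁.1 h h₂.2 hx
    · rw [abs_sub_comm t₂, abs_of_nonneg (sub_nonneg.2 h)]
      exact hU.abs_cube_sub_le (fun t ht x hx => hU.le_bound ht hx) h₂.1 h h₁.2 hx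
  · rw [← hUu t ht]
    exact hU.exists_holderOnWith ht
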